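/- Let $d\ge 1$ and let $\Pi$ be the set of all stochastic matrices $\pi=(\pi(x,y))_{x,y\in\mathbb{Z}^d}$, i.e. $\pi(x,y)\in[0,1]$ and $\sum_{y}\pi(x,y)=1$ for all $x$, with its Borel (product) $\sigma$-field; let $\bar\Pi=\mathbb{N}_0^{\mathbb{Z}^d}\times\Pi$. For $z\in\mathbb{Z}^d$ and $\bar\pi=(n,\pi)\in\bar\Pi$ let $\varphi_z(\bar\pi)=\big((n(x+z))_x,(\pi(x+z,y+z))_{x,y}\big)$, and let $\bar K$ be the Markov kernel on $\bar\Pi$ given by $\bar K(\bar\pi,B)=\sum_{z\in\mathbb{Z}^d}\pi(0,z)\mathbf 1_B(\varphi_z(\bar\pi))$ (the augmented environment viewed from the particle). On a probability space $(\Omega,\mathcal F,P)$ let $\eta=(\eta(x))_{x\in\mathbb{Z}^d}$ be $\mathbb{N}_0$-valued random variables, let $\kappa$ be a $\Pi$-valued random variable, and let $S_j(x,i)$ ($j\ge 0$, $x\in\mathbb{Z}^d$, $i\ge 1$) be $\mathbb{Z}^d$-valued random variables with $S_0(x,i)=x$; put $\bar\kappa=(\eta,\kappa)$. Say that $y$ can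 be reached from $x$ if there are $m\ge 0$ and $x=x_0,\dots,x_m=y$ with $\kappa(x_{l-1},x_l)>0$ for all $1\le l\le m$; the cluster $\mathcal C(v)$ of $v$ is the set of all $y$ such that $y$ can be reached from $v$ and $v$ from $y$. For $v\in\mathbb{Z}^d$ let $W_0^v=\{v\}$ and, for $j\ge 1$, let $W_j^v$ be the set of all $x\notin\bigcup_{k<j}W_k^v$ for which there are $k<j$, $y\in W_k^v$ and $1\le i\le\eta(y)$ with $S_{j-k}(y,i)=x$; let $W^v=\bigcup_{j\ge 0}W_j^v$. Let $R_v$ (recurrence of $v$) be the event that there are infinitely many $x\in W^v$ for which there are $1\le i\le\eta(x)$ and $j\ge 0$ with $S_j(x,i)=v$. Assume that (i) $P$-a.s. there is at most one infinite cluster, and $P[\#\mathcal C(0)=\infty]>0$; (ii) $\bar\kappa$ is stationary with respect to the shifts, i.e. $\varphi_z(\bar\kappa)$ has the same distribution as $\bar\kappa$ for every $z\in\mathbb{Z}^d$, and ergodic, i.e. $P[A]\in\{0,1\}$ for every event $A$ for which there is a measurable $B\subseteq\bar\Pi$ with $P[A\,\triangle\,\{\varphi_z(\bar\kappa)\in B\}]=0$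 for all $z\in\mathbb{Z}^d$; (iii) given $\bar\kappa$, the sequences $(S_j(x,i))_{j\ge 0}$, $x\in\mathbb{Z}^d$, $i\ge 1$, are independent Markov chains with common transition matrix $\kappa$; (iv) there is a probability measure $\bar P$ on $\bar\Pi$ which is invariant with respect to $\bar K$ and equivalent to (mutually absolutely continuous with) the distribution of $\bar\kappa$ under $P[\,\cdot\mid\#\mathcal C(0)=\infty]$. Then the zero-one law for recurrence and transience holds: either $P[R_v]=0$ for all $v\in\mathbb{Z}^d$, or $P[R_v]=P[\eta(v)\ge 1,\ \#\mathcal C(v)=\infty]$ for all $v\in\mathbb{Z}^d$. -/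

import Mathlib

open MeasureTheory ProbabilityTheory

noncomputable section

namespace FrogModel

/-! Frog configurations `(n, s)` on a set `V`: `n x` is the number of initial frogs at `x`,
and `s j x i` is the position after `j` steps of the `i`-th frog (`i ≥ 1`) originating at `x`. -/

section Frogs

variable {V : Type*}

/-- `wake n s v j` is the set of sites visited at time `j` for the first time by an active frog,
when the initial frogs at `v` are woken up at time `0`. -/
def wake (n : V → ℕ) (s : ℕ → V → ℕ+ → V) (v : V) : ℕ → Set V
  | 0 => {v}
  | j + 1 =>
    {x | (∀ k : Fin (j + 1), x ∉ wake n s v k) ∧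
      ∃ k : Fin (j + 1), ∃ y ∈ wake n s v k, ∃ i : ℕ+, (i : ℕ) ≤ n y ∧ s (j + 1 - k) y i = x}
  termination_by j => j
  decreasing_by all_goals exact k.isLt

/-- The set of sites ever visited by an active frog, starting from the frogs at `v`. -/
def wakeAll (n : V → ℕ) (s : ℕ → V → ℕ+ → V) (v : V) : Set V :=
  ⋃ j : ℕ, wake n s v j

/-- `v` is recurrent for `(n, s)`: there are infinitely many `x ∈ wakeAll n s v` such that one of
the initial frogs of `x` visits `v`. -/
def Recurrent (n : V → ℕ) (s : ℕ → V → ℕ+ → V) (v : V) : Prop :=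
  {x | x ∈ wakeAll n s v ∧ ∃ i : ℕ+, (i : ℕ) ≤ n x ∧ ∃ j : ℕ, s j x i = v}.Infinite

/-- `y` can be reached from `x` through finitely many steps of positive weight. -/
def CanReach (π : V → V → ℝ) (x y : V) : Prop :=
  Relation.ReflTransGen (fun a b => 0 < π a b) x y

/-- The cluster of `v`: its equivalence class for mutual reachability. -/
def cluster (π : V → V → ℝ) (v : V) : Set V :=
  {y | CanReach π v y ∧ CanReach π y v}

end Frogs

/-- The lattice `ℤ^d`. -/
abbrev Zd (d : ℕ) : Type := Fin d → ℤ

/-- Random walk environments: stochastic matrices on `ℤ^d`, with the product σ-field. -/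
abbrev Env (d : ℕ) : Type :=
  {π : Zd d → Zd d → ℝ //
    (∀ x y, π x y ∈ Set.Icc (0 : ℝ) 1) ∧ ∀ x, HasSum (fun y => π x y) 1}

/-- Augmented environments: numbers of initial frogs together with an environment. -/
abbrev AugEnv (d : ℕ) : Type := (Zd d → ℕ) × Env d

variable {d : ℕ}

/-- The shift of an environment: `(x, y) ↦ π (x + z) (y + z)`. -/
def shiftEnv (z : Zd d) (π : Env d) : Env d :=
  ⟨fun x y => π.1 (x + z) (y + z), fun _ _ => π.2.1 _ _, fun x =>
    (Equiv.addRight z).hasSum_iff.2 (π.2.2 (x + z))⟩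

/-- The shift of an augmented environment. -/
def shiftAug (z : Zd d) (p : AugEnv d) : AugEnv d :=
  (fun x => p.1 (x + z), shiftEnv z p.2)

theorem measurable_entry (x y : Zd d) : Measurable fun π : Env d => π.1 x y :=
  (measurable_pi_apply y).comp ((measurable_pi_apply x).comp measurable_subtype_coe)

theorem measurable_shiftAug (z : Zd d) : Measurable (shiftAug z : AugEnv d → AugEnv d) := by
  refine Measurable.prodMk ?_ ?_
  · exact measurable_pi_lambda _ fun x => (measurable_pi_apply (x + z)).comp measurable_fst
  · refine Measurable.subtype_mk ?_
    exact measurable_pi_lambda _ fun x => measurable_pi_lambda _ fun y =>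
      (measurable_entry (x + z) (y + z)).comp measurable_snd

/-- The transition kernel of the augmented environment viewed from the particle:
`(n, π)` moves to its shift by `z` with probability `π 0 z`. -/
def augKernel (d : ℕ) : Kernel (AugEnv d) (AugEnv d) where
  toFun p := Measure.sum fun z : Zd d =>
    ENNReal.ofReal (p.2.1 0 z) • Measure.dirac (shiftAug z p)
  measurable' := by
    refine Measure.measurable_of_measurable_coe _ fun B hB => ?_
    simp only [Measure.sum_apply _ hB, Measure.smul_apply, Measure.dirac_apply' _ hB, smul_eq_mul]
    refine Measurable.tsum fun z => Measurable.mul ?_ ?_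
    · exact ((measurable_entry 0 z).comp measurable_snd).ennreal_ofReal
    · exact (measurable_one.indicator hB).comp (measurable_shiftAug z)

/-- The probability that a random walk in the environment `π` started at `x` follows
the path `a` during its first `m` steps. -/
def pathProb (π : Env d) (x : Zd d) (a : ℕ → Zd d) (m : ℕ) : ℝ :=
  (if a 0 = x then 1 else 0) * ∏ j ∈ Finset.range m, π.1 (a j) (a (j + 1))

section Random

variable {Ω : Type*} [MeasurableSpace Ω]

/-- Stationarity under the shifts of `ℤ^d`. -/
def Stationary (μ : Measure Ω) (F : Ω → AugEnv d) : Prop :=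
  ∀ z : Zd d, μ.map (fun ω => shiftAug z (F ω)) = μ.map F

/-- Ergodicity under the shifts of `ℤ^d`. -/
def ErgodicShifts (μ : Measure Ω) (F : Ω → AugEnv d) : Prop :=
  ∀ A : Set Ω, MeasurableSet A →
    (∃ B : Set (AugEnv d), MeasurableSet B ∧
      ∀ z : Zd d, A =ᵐ[μ] {ω | shiftAug z (F ω) ∈ B}) →
    μ A = 0 ∨ μ A = 1

/-- Given the augmented environment `(η, κ)`, the paths `S · x i` (`x ∈ ℤ^d`, `i ≥ 1`) are
independent Markov chains started at `x` with common transition matrix `κ`: the conditional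
finite-dimensional distributions are the products of those of the individual chains. -/
def IndepWalksGiven (μ : Measure Ω) (η : Ω → Zd d → ℕ) (κ : Ω → Env d)
    (S : Ω → ℕ → Zd d → ℕ+ → Zd d) : Prop :=
  ∀ (I : Finset (Zd d × ℕ+)) (m : ℕ) (a : Zd d × ℕ+ → ℕ → Zd d),
    condExp (MeasurableSpace.comap (fun ω => ((η ω, κ ω) : AugEnv d)) inferInstance) μ
        (Set.indicator {ω | ∀ f ∈ I, ∀ j ≤ m, S ω j f.1 f.2 = a f j} fun _ => (1 : ℝ))
      =ᵐ[μ] fun ω => ∏ f ∈ I, pathProb (κ ω) f.1 (a f) m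

/-- Almost surely there is at most one infinite cluster. -/
def UniqueInfiniteCluster (μ : Measure Ω) (κ : Ω → Env d) : Prop :=
  ∀ᵐ ω ∂μ, ∀ x y : Zd d, (cluster (κ ω).1 x).Infinite → (cluster (κ ω).1 y).Infinite →
    cluster (κ ω).1 x = cluster (κ ω).1 y

/-- The zero-one law for recurrence and transience. -/
def ZeroOneLaw (μ : Measure Ω) (η : Ω → Zd d → ℕ) (κ : Ω → Env d)
    (S : Ω → ℕ → Zd d → ℕ+ → Zd d) : Prop :=
  (∀ v : Zd d, μ {ω | Recurrent (η ω) (S ω) v} = 0) ∨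
    ∀ v : Zd d, μ {ω | Recurrent (η ω) (S ω) v} =
      μ {ω | 1 ≤ η ω v ∧ (cluster (κ ω).1 v).Infinite}

end Random

end FrogModel

end

open FrogModel

/-! Given the environment, drive every frog by its own i.i.d. uniform variables stacked at the
sites, through a step rule that commutes with the shifts (`StepRule`). By `map_env_paths_eq` this
does not change the joint law, so everything can be done for the random set `recSet` of recurrent
sites as a function of environment and stacks.

The event that `recSet` is nonempty is shift invariant. Since the stacks are i.i.d., its quenched
probability is 0 or 1 (`ae_measure_section_eq_zero_or_one`), and ergodicity makes the same
alternative hold for almost every environment (`recSet_zero_one`). If `recSet` is almost surely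
empty, no site is recurrent.

Otherwise let h(x) be the probability that an extra independent walk from x hits `recSet`. This h is
superharmonic. Under the measure invariant for the environment viewed from the particle, both sides
of the superharmonic inequality at 0 have the same finite integral, so h is harmonic at 0
(`ae_hitRec_harmonic`). Stationarity and absolute continuity carry this to every site of an infinite
cluster. As h = 1 on `recSet`, which lies in the unique infinite cluster, the maximum principle
gives h = 1 on that whole cluster (`hitRec_eq_one_of_mem_cluster`).

So an independent walk from an occupied v in the infinite cluster hits some recurrent y. Infinitely
many visits at y produce infinitely many at v: each visiting frog has a fixed positive chance to
take a prescribed next step (`ae_infVisits_step`, from the Borel–Cantelli lemma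
`ae_infinite_inter_of_local`). Exchanging the extra walk with the first frog of v then shows that v
itself is recurrent (`ae_infVisits_of_walk`). Conversely a recurrent site is occupied and has an
infinite cluster (`InfVisits.cluster_infinite`). -/

noncomputable section

namespace FrogModel

/-! ### Pathwise facts: activation as reachability, removal of one frog, walks read off stacks. -/

section Deterministic

variable {V 𝒰 : Type*}

/-- Some initial frog of `x` visits `z`. -/
def Visits (n : V → ℕ) (s : ℕ → V → ℕ+ → V) (x z : V) : Prop :=
  ∃ i : ℕ+, (i : ℕ) ≤ n x ∧ ∃ j : ℕ, s j x i = z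

/-- The sites that can be activated from `v`, as a reachability class. -/
def Awake (n : V → ℕ) (s : ℕ → V → ℕ+ → V) (v : V) : Set V :=
  {x | Relation.ReflTransGen (Visits n s) v x}

/-- Infinitely many sites activated from `v` have a frog that visits `y`. -/
def InfVisits (n : V → ℕ) (s : ℕ → V → ℕ+ → V) (v y : V) : Prop :=
  {x | x ∈ Awake n s v ∧ Visits n s x y}.Infinite

/-- The activation times are irrelevant for recurrence; reachability is easier to transport, to
localize and to prove measurable. -/
theorem wakeAll_eq_awake (n : V → ℕ) (s : ℕ → V → ℕ+ → V) (hs : ∀ x i, s 0 x i = x) (v : V) :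
    wakeAll n s v = Awake n s v := by
  ext x
  simp only [wakeAll, Set.mem_iUnion]
  constructor
  · rintro ⟨j, hj⟩
    induction j using Nat.strong_induction_on generalizing x with
    | _ j ih =>
      cases j with
      | zero =>
        rw [wake] at hj
        rw [Set.mem_singleton_iff.1 hj]
        exact Relation.ReflTransGen.refl
      | succ j =>
        rw [wake] at hj
        obtain ⟨-, k, y, hy, i, hi, hx⟩ := hj
        exact Relation.ReflTransGen.tail (ih k k.isLt y hy) ⟨i, hi, _, hx⟩
  · intro h
    induction h with
    | refl => exact ⟨0, by rw [wake]; rfl⟩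
    | @tail y x _ hyx ih =>
      obtain ⟨k, hk⟩ := ih
      obtain ⟨i, hi, j, hj⟩ := hyx
      cases j with
      | zero =>
        rw [hs] at hj
        exact ⟨k, hj ▸ hk⟩
      | succ j =>
        -- The sets `wake` record first visits only, so `x` may already belong to an earlier one.
        by_cases h : ∃ l : Fin (k + j + 1), x ∈ wake n s v l
        · obtain ⟨l, hl⟩ := h
          exact ⟨l, hl⟩
        · push Not at h
          refine ⟨k + j + 1, ?_⟩
          rw [wake]
          refine ⟨h, ⟨k, by omega⟩, y, hk, i, hi, ?_⟩
          have : k + j + 1 - k = j + 1 := by omega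
          simpa [this] using hj

theorem recurrent_iff (n : V → ℕ) (s : ℕ → V → ℕ+ → V) (hs : ∀ x i, s 0 x i = x) (v : V) :
    Recurrent n s v ↔ InfVisits n s v v := by
  rw [Recurrent, InfVisits, wakeAll_eq_awake n s hs]
  rfl

/-- Some initial frog of `x` other than the frog `o` visits `z`. -/
def VisitsEx (n : V → ℕ) (s : ℕ → V → ℕ+ → V) (o : V × ℕ+) (x z : V) : Prop :=
  ∃ i : ℕ+, (i : ℕ) ≤ n x ∧ (x, i) ≠ o ∧ ∃ j : ℕ, s j x i = z

/-- Without the frog `o`, waking up the frogs on `Γ` leads to infinitely many visits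
at the initial site of `o`. -/
def InfVisitsEx (n : V → ℕ) (s : ℕ → V → ℕ+ → V) (o : V × ℕ+) (Γ : Set V) : Prop :=
  {x | (∃ y ∈ Γ, Relation.ReflTransGen (VisitsEx n s o) y x) ∧ VisitsEx n s o x o.1}.Infinite

theorem VisitsEx.visits {n : V → ℕ} {s : ℕ → V → ℕ+ → V} {o : V × ℕ+} {x z : V}
    (h : VisitsEx n s o x z) : Visits n s x z := by
  obtain ⟨i, hi, -, j, hj⟩ := h
  exact ⟨i, hi, j, hj⟩

/-- Cut each activation chain after its last use of the frog `o`. What remains avoids `o` and starts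
either in `Γ` or on the trajectory of `o`; one of the two sources must account for infinitely many
sites. -/
theorem InfVisits.infVisitsEx {n : V → ℕ} {s : ℕ → V → ℕ+ → V} {o : V × ℕ+} {y : V} {Γ : Set V}
    (hy : y ∈ Γ) (h : InfVisits n s y o.1) :
    InfVisitsEx n s o Γ ∨ InfVisitsEx n s o (Set.range fun j => s j o.1 o.2) := by
  have key : ∀ x ∈ Awake n s y, ∃ y' ∈ Γ ∪ Set.range fun j => s j o.1 o.2,
      Relation.ReflTransGen (VisitsEx n s o) y' x := by
    intro x hx
    induction hx with
    | refl => exact ⟨y, Or.inl hy, .refl⟩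
    | @tail b c _ hbc ih =>
      obtain ⟨i, hi, j, hj⟩ := hbc
      by_cases ho : (b, i) = o
      · exact ⟨c, Or.inr ⟨j, by rw [← ho]; exact hj⟩, .refl⟩
      · obtain ⟨y', hy', h'⟩ := ih
        exact ⟨y', hy', h'.tail ⟨i, hi, ho, j, hj⟩⟩
  have hsub : {x | x ∈ Awake n s y ∧ Visits n s x o.1} ⊆ {o.1} ∪
      ({x | (∃ y ∈ Γ, Relation.ReflTransGen (VisitsEx n s o) y x) ∧ VisitsEx n s o x o.1} ∪
      {x | (∃ y ∈ Set.range fun j => s j o.1 o.2, Relation.ReflTransGen (VisitsEx n s o) y x) ∧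
        VisitsEx n s o x o.1}) := by
    rintro x ⟨hx, i, hi, j, hj⟩
    -- Only at its own initial site could `o` be the visiting frog; losing this one site does not
    -- affect infinitude.
    by_cases hxo : x = o.1
    · exact Or.inl hxo
    · have hv : VisitsEx n s o x o.1 := ⟨i, hi, fun h => hxo (by rw [← h]), j, hj⟩
      obtain ⟨y', hy' | hy', h'⟩ := key x hx
      · exact Or.inr (Or.inl ⟨⟨y', hy', h'⟩, hv⟩)
      · exact Or.inr (Or.inr ⟨⟨y', hy', h'⟩, hv⟩)
  have hinf := (Set.Infinite.mono hsub h)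
  rw [Set.infinite_union, Set.infinite_union] at hinf
  rcases hinf with h0 | h1
  · exact absurd (Set.finite_singleton _) h0
  · exact h1

theorem InfVisitsEx.infVisits {n : V → ℕ} {s : ℕ → V → ℕ+ → V} {o : V × ℕ+}
    (ho : (o.2 : ℕ) ≤ n o.1) (h : InfVisitsEx n s o (Set.range fun j => s j o.1 o.2)) :
    InfVisits n s o.1 o.1 := by
  refine Set.Infinite.mono ?_ h
  rintro x ⟨⟨y, ⟨j, hj⟩, hy⟩, hv⟩
  refine ⟨Relation.ReflTransGen.head ⟨o.2, ho, j, hj⟩ ?_, hv.visits⟩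
  exact Relation.ReflTransGen.mono (fun _ _ h => h.visits) _ _ hy

theorem infVisitsEx_congr {n : V → ℕ} {s s' : ℕ → V → ℕ+ → V} {o : V × ℕ+} {Γ : Set V}
    (h : ∀ j x i, (x, i) ≠ o → s j x i = s' j x i) :
    InfVisitsEx n s o Γ ↔ InfVisitsEx n s' o Γ := by
  have : VisitsEx n s o = VisitsEx n s' o := by
    funext x z
    refine propext (exists_congr fun i => and_congr_right fun _ => and_congr_right fun hi =>
      exists_congr fun j => ?_)
    rw [h j x i hi]
  rw [InfVisitsEx, InfVisitsEx, this]

theorem Visits.of_shift {W : Type*} (e : V ≃ W) {n : V → ℕ} {s : ℕ → V → ℕ+ → V} {n' : W → ℕ}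
    {s' : ℕ → W → ℕ+ → W} (hn : ∀ x, n' (e x) = n x)
    (hs : ∀ j x i, s' j (e x) i = e (s j x i)) (x z : V) :
    Visits n' s' (e x) (e z) ↔ Visits n s x z := by
  simp only [Visits, hn, hs, e.apply_eq_iff_eq]

theorem awake_shift {W : Type*} (e : V ≃ W) {n : V → ℕ} {s : ℕ → V → ℕ+ → V} {n' : W → ℕ}
    {s' : ℕ → W → ℕ+ → W} (hn : ∀ x, n' (e x) = n x)
    (hs : ∀ j x i, s' j (e x) i = e (s j x i)) (v x : V) :
    e x ∈ Awake n' s' (e v) ↔ x ∈ Awake n s v := by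
  constructor
  · intro h
    have := Relation.ReflTransGen.lift (r := Visits n' s') (p := Visits n s) e.symm
      (fun a b hab => by
        rw [Function.onFun, ← Visits.of_shift e hn hs]
        simpa using hab) _ _ h
    simpa [Awake, Function.onFun] using this
  · intro h
    exact Relation.ReflTransGen.lift (r := Visits n s) (p := Visits n' s') e
      (fun a b hab => (Visits.of_shift e hn hs a b).2 hab) _ _ h

theorem infVisits_shift {W : Type*} (e : V ≃ W) {n : V → ℕ} {s : ℕ → V → ℕ+ → V} {n' : W → ℕ}
    {s' : ℕ → W → ℕ+ → W} (hn : ∀ x, n' (e x) = n x)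
    (hs : ∀ j x i, s' j (e x) i = e (s j x i)) (v y : V) :
    InfVisits n' s' (e v) (e y) ↔ InfVisits n s v y := by
  have : {x | x ∈ Awake n' s' (e v) ∧ Visits n' s' x (e y)} =
      e '' {x | x ∈ Awake n s v ∧ Visits n s x y} := by
    ext x
    obtain ⟨x, rfl⟩ := e.surjective x
    simp only [Set.mem_ofPred_eq, awake_shift e hn hs, Visits.of_shift e hn hs,
      Set.mem_image, e.apply_eq_iff_eq, exists_eq_right]
  rw [InfVisits, this, Set.infinite_image_iff e.injective.injOn]
  rfl

variable [DecidableEq V]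

/-- Remove the first entry of the stack at `x`. -/
def pop (x : V) (w : V × ℕ → 𝒰) : V × ℕ → 𝒰 :=
  fun c => if c.1 = x then w (x, c.2 + 1) else w c

/-- The walk started at `x` that uses the `k`-th entry of the stack at `y` to choose, by the
rule `g`, the step after its `k`-th visit at `y`. -/
def walk (g : V → 𝒰 → V) : V → (V × ℕ → 𝒰) → ℕ → V
  | x, _, 0 => x
  | x, w, j + 1 => walk g (g x (w (x, 0))) (pop x w) j

/-- The frogs driven by the stacks `U`. -/
def frogs (g : V → 𝒰 → V) (U : V × ℕ+ → V × ℕ → 𝒰) : ℕ → V → ℕ+ → V :=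
  fun j x i => walk g x (U (x, i)) j

theorem pop_of_ne {x y : V} (h : y ≠ x) (w : V × ℕ → 𝒰) (k : ℕ) : pop x w (y, k) = w (y, k) := by
  simp [pop, h]

theorem walk_congr (g : V → 𝒰 → V) (y : V) (j : ℕ) :
    ∀ (x : V) (w w' : V × ℕ → 𝒰), (∀ c, c.1 ≠ y → w c = w' c) →
      (∀ k < j, walk g x w k ≠ y) → walk g x w j = walk g x w' j := by
  induction j with
  | zero => intros; rfl
  | succ j ih =>
    intro x w w' hw hj
    have hx : x ≠ y := hj 0 (Nat.succ_pos j)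
    rw [walk, walk, ← hw (x, 0) hx]
    refine ih _ _ _ (fun c hc => ?_) fun k hk => hj (k + 1) (by omega)
    simp only [pop]
    split_ifs
    · exact hw _ hx
    · exact hw _ hc

/-- The entry `(y, 0)` is still on top when `y` is visited for the first time, so it determines the
step taken then. -/
theorem walk_visits_next (g : V → 𝒰 → V) (y : V) (j : ℕ) :
    ∀ (x : V) (w : V × ℕ → 𝒰), walk g x w j = y → ∃ k, walk g x w k = g y (w (y, 0)) := by
  induction j with
  | zero =>
    intro x w h
    rw [walk] at h
    subst h
    exact ⟨1, rfl⟩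
  | succ j ih =>
    intro x w h
    by_cases hx : x = y
    · subst hx
      exact ⟨1, rfl⟩
    · obtain ⟨k, hk⟩ := ih _ _ h
      rw [pop_of_ne (Ne.symm hx)] at hk
      exact ⟨k + 1, hk⟩

theorem walk_reach (g : V → 𝒰 → V) (r : V → V → Prop) (j : ℕ) :
    ∀ (x : V) (w : V × ℕ → 𝒰), (∀ c, r c.1 (g c.1 (w c))) →
      Relation.ReflTransGen r x (walk g x w j) := by
  induction j with
  | zero => intros; exact .refl
  | succ j ih =>
    intro x w hw
    refine Relation.ReflTransGen.head (hw (x, 0)) (ih _ _ fun c => ?_)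
    simp only [pop]
    split_ifs with h
    · have := hw (x, c.2 + 1)
      rwa [h]
    · exact hw c

theorem walk_shift {W : Type*} [DecidableEq W] (e : V ≃ W) (g : V → 𝒰 → V) (g' : W → 𝒰 → W)
    (hg : ∀ x u, g' (e x) u = e (g x u)) (j : ℕ) :
    ∀ (x : V) (w : V × ℕ → 𝒰) (w' : W × ℕ → 𝒰), (∀ c, w' (e c.1, c.2) = w c) →
      walk g' (e x) w' j = e (walk g x w j) := by
  induction j with
  | zero => intros; rfl
  | succ j ih =>
    intro x w w' hw
    rw [walk, walk, hw (x, 0), hg]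
    refine ih _ _ _ fun c => ?_
    simp only [pop, e.apply_eq_iff_eq]
    split_ifs
    · exact hw (x, c.2 + 1)
    · exact hw c

/-- The frogs of sites activated from `v` that visit `y`. -/
def visitors (n : V → ℕ) (g : V → 𝒰 → V) (v y : V) (U : V × ℕ+ → V × ℕ → 𝒰) : Set (V × ℕ+) :=
  {f | f.1 ∈ Awake n (frogs g U) v ∧ (f.2 : ℕ) ≤ n f.1 ∧ ∃ j, walk g f.1 (U f) j = y}

/-- A frog that never visits `y` never reads its stack at `y`. Hence the set of visitors of `y` is
determined by the stacks away from `y` and by the full stacks of the visitors themselves, which is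
the locality needed for Borel–Cantelli. -/
theorem visitors_congr {n : V → ℕ} {g : V → 𝒰 → V} {v y : V} {U U' : V × ℕ+ → V × ℕ → 𝒰}
    (h1 : ∀ f c, c.1 ≠ y → U f c = U' f c) (h2 : ∀ f ∈ visitors n g v y U, U f = U' f) :
    visitors n g v y U = visitors n g v y U' := by
  have hpath : ∀ x ∈ Awake n (frogs g U) v, ∀ i : ℕ+, (i : ℕ) ≤ n x → ∀ j,
      walk g x (U (x, i)) j = walk g x (U' (x, i)) j := by
    intro x hx i hi j
    by_cases hv : ∃ k, walk g x (U (x, i)) k = y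
    · rw [h2 (x, i) ⟨hx, hi, hv⟩]
    · push Not at hv
      exact walk_congr g y j x _ _ (h1 _) fun k _ => hv k
  have hvis : ∀ x ∈ Awake n (frogs g U) v, ∀ z,
      Visits n (frogs g U) x z ↔ Visits n (frogs g U') x z := by
    intro x hx z
    refine exists_congr fun i => and_congr_right fun hi => exists_congr fun j => ?_
    rw [frogs, frogs, hpath x hx i hi j]
  have hA : Awake n (frogs g U) v = Awake n (frogs g U') v := by
    ext x
    constructor
    · intro h
      induction h with
      | refl => exact .refl
      | @tail b c hb hbc ih => exact ih.tail ((hvis b hb c).1 hbc)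
    · intro h
      induction h with
      | refl => exact .refl
      | @tail b c hb hbc ih => exact ih.tail ((hvis b ih c).2 hbc)
  ext f
  simp only [visitors, Set.mem_ofPred_eq, ← hA]
  refine and_congr_right fun hf => and_congr_right fun hi => exists_congr fun j => ?_
  rw [hpath f.1 hf f.2 hi j]

theorem visitors_infinite {n : V → ℕ} {g : V → 𝒰 → V} {v y : V} {U : V × ℕ+ → V × ℕ → 𝒰}
    (h : InfVisits n (frogs g U) v y) : (visitors n g v y U).Infinite := by
  refine Set.Infinite.of_image Prod.fst (h.mono ?_)
  rintro x ⟨hx, i, hi, j, hj⟩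
  exact ⟨(x, i), ⟨hx, hi, j, hj⟩, rfl⟩

/-- Each site carries finitely many frogs, so infinitely many frogs come from infinitely many sites.
-/
theorem infVisits_of_infinite {n : V → ℕ} {g : V → 𝒰 → V} {v y : V} {U : V × ℕ+ → V × ℕ → 𝒰}
    {A : Set (V × ℕ+)} (hA : A.Infinite) (h1 : ∀ f ∈ A, f.1 ∈ Awake n (frogs g U) v)
    (h2 : ∀ f ∈ A, (f.2 : ℕ) ≤ n f.1) (h3 : ∀ f ∈ A, ∃ j, walk g f.1 (U f) j = y) :
    InfVisits n (frogs g U) v y := by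
  have : (Prod.fst '' A).Infinite := by
    intro hfin
    refine hA (Set.Finite.of_finite_fibers Prod.fst hfin fun x _ => ?_)
    have hsub : A ∩ Prod.fst ⁻¹' {x} ⊆ (fun i : ℕ+ => (x, i)) '' {i : ℕ+ | (i : ℕ) ≤ n x} := by
      rintro ⟨x', i⟩ ⟨hf, hx⟩
      simp only [Set.mem_preimage, Set.mem_singleton_iff] at hx
      subst hx
      exact ⟨i, h2 _ hf, rfl⟩
    refine Set.Finite.subset (Set.Finite.image _ ?_) hsub
    exact Set.Finite.of_finite_image (f := ((↑) : ℕ+ → ℕ))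
      ((Set.finite_Iic (n x)).subset (by rintro _ ⟨i, hi, rfl⟩; exact hi))
      PNat.coe_injective.injOn
  refine this.mono ?_
  rintro _ ⟨f, hf, rfl⟩
  exact ⟨h1 f hf, f.2, h2 f hf, h3 f hf⟩

end Deterministic

/-! ### Resampling in i.i.d. families and a Borel–Cantelli lemma along a self-determined random set.
-/

section ProductMeasures

open scoped ENNReal symmDiff

variable {ι 𝒰 : Type*} [MeasurableSpace 𝒰]

/-- Inserting an independent coordinate in an i.i.d. family. -/
theorem map_insert_infinitePi {κ : Type*} [DecidableEq κ] (ν : Measure 𝒰) [IsProbabilityMeasure ν]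
    (σ : κ → ι) (c₀ : κ) (hσ : Set.InjOn σ {c₀}ᶜ) :
    ((Measure.infinitePi fun _ : ι => ν).prod ν).map
      (fun p c => if c = c₀ then p.2 else p.1 (σ c)) = Measure.infinitePi fun _ : κ => ν := by
  have hmeas : Measurable fun (p : (ι → 𝒰) × 𝒰) (c : κ) => if c = c₀ then p.2 else p.1 (σ c) := by
    refine measurable_pi_lambda _ fun c => ?_
    split_ifs <;> fun_prop
  refine Measure.eq_infinitePi _ fun s t ht => ?_
  rw [Measure.map_apply hmeas (MeasurableSet.pi s.countable_toSet fun i _ => ht i)]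
  have hinj : Function.Injective fun c : (s.erase c₀ : Finset κ) => σ c := by
    intro a b h
    exact Subtype.ext (hσ (Finset.ne_of_mem_erase a.2) (Finset.ne_of_mem_erase b.2) h)
  have hpre : (fun (p : (ι → 𝒰) × 𝒰) (c : κ) => if c = c₀ then p.2 else p.1 (σ c)) ⁻¹'
      (s : Set κ).pi t
      = ((fun (w : ι → 𝒰) (c : (s.erase c₀ : Finset κ)) => w (σ c)) ⁻¹'
        Set.univ.pi fun c : (s.erase c₀ : Finset κ) => t c) ×ˢ {u | c₀ ∈ s → u ∈ t c₀} := by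
    ext ⟨w, u⟩
    simp only [Set.mem_preimage, Set.mem_pi, Finset.mem_coe, Set.mem_prod, Set.mem_univ,
      Set.mem_ofPred_eq, Subtype.forall, Finset.mem_erase, forall_true_left]
    constructor
    · intro h
      refine ⟨fun c hc => ?_, fun hc => ?_⟩
      · simpa [hc.1] using h c hc.2
      · simpa using h c₀ hc
    · rintro ⟨h1, h2⟩ c hc
      split_ifs with h
      · exact h ▸ h2 (h ▸ hc)
      · exact h1 c ⟨h, hc⟩
  have hm' : MeasurableSet (Set.univ.pi fun c : (s.erase c₀ : Finset κ) => t c) :=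
    MeasurableSet.univ_pi fun c => ht c.1
  rw [hpre, Measure.prod_prod, ← Measure.map_apply (by fun_prop) hm',
    Measure.map_infinitePi_infinitePi_of_inj hinj,
    Measure.infinitePi_eq_pi, Measure.pi_pi, Finset.prod_coe_sort (s.erase c₀) fun c => ν (t c)]
  by_cases h : c₀ ∈ s
  · simp only [h, forall_true_left]
    rw [mul_comm]
    exact Finset.mul_prod_erase s (fun c => ν (t c)) h
  · simp [h]

/-- Combining two independent i.i.d. families coordinatewise. -/
theorem map_combine_infinitePi {A B : Type*} [MeasurableSpace A] [MeasurableSpace B]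
    (α : Measure A) [IsProbabilityMeasure α] (β : Measure B) [IsProbabilityMeasure β]
    (ν : Measure 𝒰) [IsProbabilityMeasure ν] (m : A × B → 𝒰) (hm : Measurable m)
    (hmap : (α.prod β).map m = ν) :
    ((Measure.infinitePi fun _ : ι => α).prod (Measure.infinitePi fun _ : ι => β)).map
      (fun p i => m (p.1 i, p.2 i)) = Measure.infinitePi fun _ : ι => ν := by
  have hmeas : Measurable fun (p : (ι → A) × (ι → B)) (i : ι) => m (p.1 i, p.2 i) := by fun_prop
  refine Measure.eq_infinitePi _ fun s t ht => ?_
  have hbox : MeasurableSet ((s : Set ι).pi t) :=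
    MeasurableSet.pi s.countable_toSet fun i _ => ht i
  rw [Measure.map_apply hmeas hbox, Measure.prod_apply (hmeas hbox)]
  have hφ : ∀ i, Measurable fun a => β {b | m (a, b) ∈ t i} := fun i =>
    measurable_measure_prodMk_left (hm (ht i))
  have h1 : ∀ a : ι → A, (Measure.infinitePi fun _ : ι => β)
      (Prod.mk a ⁻¹' ((fun (p : (ι → A) × (ι → B)) (i : ι) => m (p.1 i, p.2 i)) ⁻¹'
        (s : Set ι).pi t)) = ∏ i ∈ s, β {b | m (a i, b) ∈ t i} := by
    intro a
    rw [← Measure.infinitePi_pi (μ := fun _ : ι => β) (s := s)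
      (t := fun i => {b | m (a i, b) ∈ t i})]
    · rfl
    · intro i _
      exact (hm.comp measurable_prodMk_left) (ht i)
  simp_rw [h1]
  have hind := iIndepFun_infinitePi (P := fun _ : ι => α)
    (X := fun i a => β {b | m (a, b) ∈ t i}) hφ
  rw [lintegral_prod_eq_prod_lintegral_of_indepFun s _ hind
    fun i => (hφ i).comp (measurable_pi_apply i)]
  refine Finset.prod_congr rfl fun i _ => ?_
  rw [← hmap, Measure.map_apply hm (ht i), Measure.prod_apply (hm (ht i))]
  exact (measurePreserving_eval_infinitePi (fun _ : ι => α) i).lintegral_comp (hφ i)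

theorem ae_exists_mem_of_infinite (ν : Measure 𝒰) [IsProbabilityMeasure ν] {J : Set 𝒰}
    (hJ : MeasurableSet J) (hpos : ν J ≠ 0) {C : Set ι} (hC : C.Infinite) :
    Measure.infinitePi (fun _ : ι => ν) {t | ∀ c ∈ C, t c ∉ J} = 0 := by
  have hlt : ν Jᶜ < 1 := by
    rw [prob_compl_eq_one_sub hJ]
    exact ENNReal.sub_lt_self ENNReal.one_ne_top one_ne_zero hpos
  have hle : ∀ k : ℕ, Measure.infinitePi (fun _ : ι => ν) {t | ∀ c ∈ C, t c ∉ J} ≤ ν Jᶜ ^ k := by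
    intro k
    obtain ⟨s, hs, rfl⟩ := hC.exists_subset_card_eq k
    calc _ ≤ Measure.infinitePi (fun _ : ι => ν) ((s : Set ι).pi fun _ => Jᶜ) :=
          measure_mono fun t (ht : ∀ c ∈ (_ : Set ι), t c ∉ J) c hc => ht c (hs hc)
      _ = ν Jᶜ ^ s.card := by
          rw [Measure.infinitePi_pi _ fun _ _ => hJ.compl, Finset.prod_const]
  have := ge_of_tendsto' (ENNReal.tendsto_pow_atTop_nhds_zero_of_lt_one hlt) hle
  simpa using this

theorem measurableSet_infinite {A : Type*} [MeasurableSpace A] [Countable ι] {I : A → Set ι}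
    (hI : ∀ c, MeasurableSet {a | c ∈ I a}) : MeasurableSet {a | (I a).Infinite} := by
  have : {a | (I a).Infinite} = ⋂ s : Finset ι, ⋃ c : ι, {a | c ∉ s ∧ c ∈ I a} := by
    ext a
    simp only [Set.mem_ofPred_eq, Set.mem_iInter, Set.mem_iUnion]
    constructor
    · intro h s
      obtain ⟨c, hc, hcs⟩ := h.exists_notMem_finset s
      exact ⟨c, hcs, hc⟩
    · intro h hfin
      obtain ⟨c, hc, hc'⟩ := h hfin.toFinset
      exact hc (hfin.mem_toFinset.2 hc')
  rw [this]
  refine MeasurableSet.iInter fun s => MeasurableSet.iUnion fun c => ?_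
  exact (MeasurableSet.const _).inter (hI c)

/-- A sample from `ν` is obtained by first deciding, with an independent variable, whether it lies
in `J`, and then drawing it from the corresponding conditional law. -/
theorem map_ite_prod_cond (ν : Measure 𝒰) [IsProbabilityMeasure ν] {J : Set 𝒰}
    (hJ : MeasurableSet J) (hpos : ν J ≠ 0) (hpos' : ν Jᶜ ≠ 0) [DecidablePred (· ∈ J)] :
    (((cond ν J).prod (cond ν Jᶜ)).prod ν).map (fun p => if p.2 ∈ J then p.1.1 else p.1.2) = ν := by
  have := cond_isProbabilityMeasure hpos
  have := cond_isProbabilityMeasure hpos'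
  have hm : Measurable fun p : (𝒰 × 𝒰) × 𝒰 => if p.2 ∈ J then p.1.1 else p.1.2 :=
    Measurable.ite (measurable_snd hJ) (by fun_prop) (by fun_prop)
  ext B hB
  rw [Measure.map_apply hm hB]
  have hset : (fun p : (𝒰 × 𝒰) × 𝒰 => if p.2 ∈ J then p.1.1 else p.1.2) ⁻¹' B =
      (B ×ˢ Set.univ) ×ˢ J ∪ (Set.univ ×ˢ B) ×ˢ Jᶜ := by
    ext ⟨⟨a, b⟩, t⟩
    by_cases h : t ∈ J <;> simp [h]
  have hdisj : Disjoint ((B ×ˢ (Set.univ : Set 𝒰)) ×ˢ J) (((Set.univ : Set 𝒰) ×ˢ B) ×ˢ Jᶜ) := by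
    rw [Set.disjoint_left]
    rintro ⟨⟨a, b⟩, t⟩ h1 h2
    exact h2.2 h1.2
  rw [hset, measure_union hdisj ((MeasurableSet.univ.prod hB).prod hJ.compl)]
  simp only [Measure.prod_prod, measure_univ, mul_one, one_mul]
  rw [cond_apply hJ, cond_apply hJ.compl, mul_comm, ← mul_assoc,
    ENNReal.mul_inv_cancel hpos (measure_ne_top _ _), mul_comm (_ * _) (ν Jᶜ), ← mul_assoc,
    ENNReal.mul_inv_cancel hpos' (measure_ne_top _ _), one_mul, one_mul, Set.inter_comm,
    Set.inter_comm Jᶜ, ← Set.sdiff_eq, measure_inter_add_sdiff B hJ]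

/-- A Borel–Cantelli lemma for i.i.d. variables `u c` inspected along a random set `I u` that is
determined by the variables it contains. -/
theorem ae_infinite_inter_of_local [Countable ι] (ν : Measure 𝒰) [IsProbabilityMeasure ν]
    {J : Set 𝒰} (hJ : MeasurableSet J) (hpos : ν J ≠ 0)
    {I : (ι → 𝒰) → Set ι} (hI : ∀ c, MeasurableSet {u | c ∈ I u})
    (hloc : ∀ u u', (∀ c ∈ I u, u c = u' c) → I u = I u') :
    ∀ᵐ u ∂Measure.infinitePi fun _ : ι => ν,
      (I u).Infinite → {c | c ∈ I u ∧ u c ∈ J}.Infinite := by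
  classical
  by_cases hpos' : ν Jᶜ = 0
  · have hall : ∀ c, ∀ᵐ u ∂Measure.infinitePi fun _ : ι => ν, u c ∈ J := fun c =>
      (measurePreserving_eval_infinitePi (fun _ : ι => ν) c).quasiMeasurePreserving.ae
        (mem_ae_iff.2 hpos')
    filter_upwards [ae_all_iff.2 hall] with u hu hinf
    exact hinf.mono fun c hc => ⟨hc, hu c⟩
  have := cond_isProbabilityMeasure hpos
  have := cond_isProbabilityMeasure hpos'
  have hm : Measurable fun p : (𝒰 × 𝒰) × 𝒰 => if p.2 ∈ J then p.1.1 else p.1.2 :=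
    Measurable.ite (measurable_snd hJ) (by fun_prop) (by fun_prop)
  rw [← map_combine_infinitePi (ι := ι) ((cond ν J).prod (cond ν Jᶜ)) ν ν _ hm
    (map_ite_prod_cond ν hJ hpos hpos')]
  refine (ae_map_iff (Measurable.aemeasurable (measurable_pi_lambda _ fun i =>
    hm.comp (f := fun q : (ι → 𝒰 × 𝒰) × (ι → 𝒰) => (q.1 i, q.2 i)) (by fun_prop))) ?_).2 ?_
  · have h1 := measurableSet_infinite hI
    have h2 := measurableSet_infinite (I := fun u : ι → 𝒰 => {c | c ∈ I u ∧ u c ∈ J})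
      fun c => (hI c).inter (measurable_pi_apply c hJ)
    exact (h1.compl.union h2).congr (by ext u; simp [imp_iff_not_or])
  -- Each variable is now a candidate in `J`, a candidate outside `J`, and an independent decision.
  -- `φ b` is the configuration whose decisions for `J` occur exactly on `b`. It does not involve
  -- the decisions, so if `I (φ b q.1)` is infinite, almost surely some of its indices outside `b`
  -- decide for `J`.
  let φ : Finset ι → (ι → 𝒰 × 𝒰) → ι → 𝒰 := fun b p c => if c ∈ b then (p c).1 else (p c).2
  have hφ : ∀ b, Measurable (φ b) := by
    intro b
    refine measurable_pi_lambda _ fun c => ?_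
    simp only [φ]
    split_ifs <;> fun_prop
  have hnull : ∀ b : Finset ι, ∀ᵐ q ∂(Measure.infinitePi fun _ : ι =>
      (cond ν J).prod (cond ν Jᶜ)).prod (Measure.infinitePi fun _ : ι => ν),
      ¬ ((I (φ b q.1)).Infinite ∧ ∀ c, c ∈ I (φ b q.1) → c ∉ b → q.2 c ∉ J) := by
    intro b
    rw [ae_iff]
    simp only [not_not]
    refine (Measure.measure_prod_null ?_).2 (Filter.Eventually.of_forall fun p => ?_)
    · refine ((hφ b).comp measurable_fst (measurableSet_infinite hI)).inter ?_
      have : {q : (ι → 𝒰 × 𝒰) × (ι → 𝒰) | ∀ c, c ∈ I (φ b q.1) → c ∉ b → q.2 c ∉ J} =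
          ⋂ c, ((fun q : (ι → 𝒰 × 𝒰) × (ι → 𝒰) => φ b q.1) ⁻¹' {u | c ∈ I u})ᶜ ∪
            ({q | c ∈ b} ∪ {q | q.2 c ∈ J}ᶜ) := by
        ext q
        simp only [Set.mem_ofPred_eq, Set.mem_iInter, Set.mem_union, Set.mem_compl_iff,
          Set.mem_preimage]
        refine forall_congr' fun c => ?_
        tauto
      change MeasurableSet {q : (ι → 𝒰 × 𝒰) × (ι → 𝒰) | ∀ c, c ∈ I (φ b q.1) → c ∉ b → q.2 c ∉ J}
      rw [this]
      refine MeasurableSet.iInter fun c => MeasurableSet.union ?_ (MeasurableSet.union ?_ ?_)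
      · exact ((hφ b).comp measurable_fst (hI c)).compl
      · exact MeasurableSet.const _
      · exact (((measurable_pi_apply c).comp measurable_snd) hJ).compl
    · by_cases hinf : (I (φ b p)).Infinite
      · refine measure_mono_null ?_ (ae_exists_mem_of_infinite ν hJ hpos
          (hinf.sdiff b.finite_toSet))
        rintro t ⟨-, h⟩ c ⟨hc, hcb⟩
        exact h c hc hcb
      · refine measure_mono_null ?_ measure_empty
        rintro t ⟨h, -⟩
        exact hinf h
  have hξ : ∀ c, ∀ᵐ q ∂(Measure.infinitePi fun _ : ι => (cond ν J).prod (cond ν Jᶜ)).prod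
      (Measure.infinitePi fun _ : ι => ν), (q.1 c).1 ∈ J := by
    intro c
    have hmp := measurePreserving_fst (μ := cond ν J) (ν := cond ν Jᶜ) |>.comp
      (measurePreserving_eval_infinitePi (fun _ : ι => (cond ν J).prod (cond ν Jᶜ)) c) |>.comp
      (measurePreserving_fst (ν := Measure.infinitePi fun _ : ι => ν))
    exact hmp.quasiMeasurePreserving.ae (ae_cond_mem hJ)
  filter_upwards [ae_all_iff.2 hnull, ae_all_iff.2 hξ] with q hq hqJ hinf hfin
  have hfin' : {c | c ∈ I (fun i => if q.2 i ∈ J then (q.1 i).1 else (q.1 i).2) ∧ q.2 c ∈ J}.Finite := by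
    refine hfin.subset ?_
    rintro c ⟨hc, hcJ⟩
    refine ⟨hc, ?_⟩
    change (if q.2 c ∈ J then (q.1 c).1 else (q.1 c).2) ∈ J
    rw [if_pos hcJ]
    exact hqJ c
  -- If only finitely many indices of `I` decide for `J`, take them as `b`: on `I` the true
  -- configuration agrees with `φ b`, so locality identifies the two index sets. The countably many
  -- null sets `hnull` then give a contradiction.
  have hI' : I (fun i => if q.2 i ∈ J then (q.1 i).1 else (q.1 i).2) = I (φ hfin'.toFinset q.1) := by
    refine hloc _ _ fun c hc => ?_
    simp only [φ, Set.Finite.mem_toFinset, Set.mem_ofPred_eq, hc, true_and]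
  refine hq hfin'.toFinset ⟨hI' ▸ hinf, fun c hc hcb hcJ => hcb ?_⟩
  rw [Set.Finite.mem_toFinset]
  exact ⟨hI' ▸ hc, hcJ⟩

end ProductMeasures

/-! ### A quenched zero-one law for invariant events. -/

section ZeroOne

open scoped symmDiff

variable {ι 𝒲 : Type*} [MeasurableSpace 𝒲]

theorem infinitePi_inter_of_disjoint (ρ : Measure 𝒲) [IsProbabilityMeasure ρ] {s s' : Finset ι}
    (hs : Disjoint s s') {B B' : Set (ι → 𝒲)} (hB : MeasurableSet B) (hB' : MeasurableSet B')
    (hdep : ∀ U U', (∀ i ∈ s, U i = U' i) → U ∈ B → U' ∈ B)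
    (hdep' : ∀ U U', (∀ i ∈ s', U i = U' i) → U ∈ B' → U' ∈ B') :
    (Measure.infinitePi fun _ : ι => ρ).real (B ∩ B') =
      (Measure.infinitePi fun _ : ι => ρ).real B * (Measure.infinitePi fun _ : ι => ρ).real B' := by
  classical
  obtain ⟨w₀⟩ : Nonempty 𝒲 := nonempty_of_isProbabilityMeasure ρ
  have key : ∀ (s : Finset ι) (B : Set (ι → 𝒲)), MeasurableSet B →
      (∀ U U', (∀ i ∈ s, U i = U' i) → U ∈ B → U' ∈ B) →
      ∃ C : Set (s → 𝒲), MeasurableSet C ∧ B = (fun U (i : s) => U i) ⁻¹' C := by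
    intro s B hB hdep
    refine ⟨(fun (v : s → 𝒲) (i : ι) => if h : i ∈ s then v ⟨i, h⟩ else w₀) ⁻¹' B, ?_, ?_⟩
    · refine (measurable_pi_lambda _ fun i => ?_) hB
      split_ifs <;> fun_prop
    · ext U
      constructor
      · exact hdep _ _ fun i hi => by simp [hi]
      · exact hdep _ _ fun i hi => by simp [hi]
  obtain ⟨C, hC, rfl⟩ := key s B hB hdep
  obtain ⟨C', hC', rfl⟩ := key s' B' hB' hdep'
  have hind := (iIndepFun_infinitePi (P := fun _ : ι => ρ) (X := fun _ w => w)
    fun _ => measurable_id).indepFun_finset s s' hs fun i => measurable_pi_apply i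
  have := hind.measure_inter_preimage_eq_mul C C' hC hC'
  simp only [Measure.real, ← ENNReal.toReal_mul]
  exact congrArg ENNReal.toReal this

/-- The sets that depend on finitely many coordinates of the second component. -/
def finiteDependence (A ι 𝒲 : Type*) [MeasurableSpace A] [MeasurableSpace 𝒲] :
    Set (Set (A × (ι → 𝒲))) :=
  {E | MeasurableSet E ∧ ∃ s : Finset ι, ∀ a U U', (∀ i ∈ s, U i = U' i) → (a, U) ∈ E → (a, U') ∈ E}

theorem isSetAlgebra_finiteDependence (A : Type*) [MeasurableSpace A] :
    IsSetAlgebra (finiteDependence A ι 𝒲) where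
  empty_mem := ⟨MeasurableSet.empty, ∅, fun _ _ _ _ h => h⟩
  compl_mem := by
    rintro E ⟨hE, s, hs⟩
    exact ⟨hE.compl, s, fun a U U' h hU hU' => hU (hs a U' U (fun i hi => (h i hi).symm) hU')⟩
  union_mem := by
    classical
    rintro E E' ⟨hE, s, hs⟩ ⟨hE', s', hs'⟩
    refine ⟨hE.union hE', s ∪ s', fun a U U' h hU => ?_⟩
    rcases hU with hU | hU
    · exact Or.inl (hs a U U' (fun i hi => h i (Finset.mem_union_left _ hi)) hU)
    · exact Or.inr (hs' a U U' (fun i hi => h i (Finset.mem_union_right _ hi)) hU)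

theorem generateFrom_finiteDependence (A : Type*) [MeasurableSpace A] :
    (inferInstance : MeasurableSpace (A × (ι → 𝒲))) =
      MeasurableSpace.generateFrom (finiteDependence A ι 𝒲) := by
  refine le_antisymm ?_ (MeasurableSpace.generateFrom_le fun E hE => hE.1)
  refine sup_le ?_ ?_
  · rintro _ ⟨B, hB, rfl⟩
    exact MeasurableSpace.measurableSet_generateFrom
      ⟨measurable_fst hB, ∅, fun _ _ _ _ h => h⟩
  · rw [← measurable_iff_comap_le]
    refine @measurable_pi_lambda _ _ _ (_) _ _ fun i => ?_
    intro B hB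
    refine MeasurableSpace.measurableSet_generateFrom
      ⟨((measurable_pi_apply i).comp measurable_snd) hB, {i}, fun a U U' h hU => ?_⟩
    have := h i (Finset.mem_singleton_self i)
    change U' i ∈ B
    rw [← this]
    exact hU

/-- An event that is invariant under transformations which move any given finite set of
i.i.d. coordinates away from itself is determined by the remaining component. -/
theorem ae_measure_section_eq_zero_or_one {A : Type*} [MeasurableSpace A] (L : Measure A)
    [IsProbabilityMeasure L] (ρ : Measure 𝒲) [IsProbabilityMeasure ρ] {D : Set (A × (ι → 𝒲))}
    (hD : MeasurableSet D)
    (hshift : ∀ s : Finset ι, ∃ (φ : A → A) (σ : ι → ι) (τ : 𝒲 → 𝒲), MeasurePreserving φ L L ∧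
      Function.Injective σ ∧ MeasurePreserving τ ρ ρ ∧ (∀ i ∈ s, σ i ∉ s) ∧
      ∀ a U, (φ a, fun i => τ (U (σ i))) ∈ D ↔ (a, U) ∈ D) :
    ∀ᵐ a ∂L, (Measure.infinitePi fun _ : ι => ρ) (Prod.mk a ⁻¹' D) = 0 ∨
      (Measure.infinitePi fun _ : ι => ρ) (Prod.mk a ⁻¹' D) = 1 := by
  classical
  set Λ := Measure.infinitePi fun _ : ι => ρ with hΛ
  have hmeas : ∀ {S : Set (A × (ι → 𝒲))}, MeasurableSet S →
      Measurable fun a => Λ.real (Prod.mk a ⁻¹' S) := fun hS =>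
    (measurable_measure_prodMk_left hS).ennreal_toReal
  have hint : ∀ {S : Set (A × (ι → 𝒲))}, MeasurableSet S →
      Integrable (fun a => Λ.real (Prod.mk a ⁻¹' S)) L := fun hS =>
    Integrable.of_bound (hmeas hS).aestronglyMeasurable 1 (Filter.Eventually.of_forall fun a => by
      rw [Real.norm_eq_abs, abs_of_nonneg measureReal_nonneg]
      exact measureReal_le_one)
  set r : A → ℝ := fun a => Λ.real (Prod.mk a ⁻¹' D) with hr
  have hr0 : ∀ a, 0 ≤ r a := fun a => measureReal_nonneg
  have hr1 : ∀ a, r a ≤ 1 := fun a => measureReal_le_one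
  have hint2 : Integrable (fun a => r a - r a * r a) L :=
    Integrable.of_bound ((hmeas hD).sub ((hmeas hD).mul (hmeas hD))).aestronglyMeasurable 1
      (Filter.Eventually.of_forall fun a => by
        rw [Real.norm_eq_abs, abs_le]
        constructor <;> nlinarith [hr0 a, hr1 a])
  have hnn : ∀ a, 0 ≤ r a - r a * r a := fun a => by nlinarith [hr0 a, hr1 a]
  -- Approximate `D` by an event `E` depending on finitely many coordinates. By invariance, each
  -- section of `D` is close both to that of `E` and to that of its shift; these two are
  -- independent, so `r` is close to `r * r`.
  have hbound : ∀ ε : ℝ, 0 < ε → ∫ a, (r a - r a * r a) ∂L ≤ 4 * ε := by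
    intro ε hε
    obtain ⟨E, ⟨hE, s, hs⟩, hDE⟩ := (Measure.MeasureDense.of_generateFrom_isSetAlgebra_finite
      (L.prod Λ) (isSetAlgebra_finiteDependence (ι := ι) (𝒲 := 𝒲) A)
      (generateFrom_finiteDependence A)).approx D hD (measure_ne_top _ _) ε hε
    obtain ⟨φ, σ, τ, hφ, hσ, hτ, hσs, hinv⟩ := hshift s
    set θ : (ι → 𝒲) → (ι → 𝒲) := fun U i => τ (U (σ i))
    have hθ : MeasurePreserving θ Λ Λ := by
      refine ⟨by have := hτ.measurable; fun_prop, ?_⟩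
      have h1 : θ = (fun U i => τ (U i)) ∘ fun (U : ι → 𝒲) i => U (σ i) := rfl
      rw [h1, ← Measure.map_map (by have := hτ.measurable; fun_prop) (by fun_prop), hΛ,
        Measure.map_infinitePi_infinitePi_of_inj hσ,
        Measure.infinitePi_map_pi _ fun _ => hτ.measurable]
      simp only [hτ.map_eq]
    have hDEm : MeasurableSet (D ∆ E) := hD.symmDiff hE
    set dd : A → ℝ := fun a => Λ.real (Prod.mk a ⁻¹' (D ∆ E)) with hdd
    set e : A → ℝ := fun a => Λ.real (Prod.mk a ⁻¹' E)
    have hθreal : ∀ {S : Set (ι → 𝒲)}, MeasurableSet S → Λ.real (θ ⁻¹' S) = Λ.real S := fun hS => by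
      rw [Measure.real, Measure.real, hθ.measure_preimage hS.nullMeasurableSet]
    have hrφ : ∀ a, r (φ a) = r a := by
      intro a
      change Λ.real (Prod.mk (φ a) ⁻¹' D) = Λ.real (Prod.mk a ⁻¹' D)
      rw [← hθreal (measurable_prodMk_left hD)]
      refine congrArg _ ?_
      ext U
      exact hinv a U
    have her : ∀ a, |r a - e a| ≤ dd a := fun a =>
      abs_measureReal_sub_le_measureReal_symmDiff (measurable_prodMk_left hD).nullMeasurableSet
        (measurable_prodMk_left hE).nullMeasurableSet
    have hEE : ∀ a, Λ.real (Prod.mk a ⁻¹' E ∩ θ ⁻¹' (Prod.mk (φ a) ⁻¹' E)) = e a * e (φ a) := by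
      intro a
      rw [hΛ, infinitePi_inter_of_disjoint ρ (s := s) (s' := s.image σ) ?_
        (measurable_prodMk_left hE) (hθ.measurable (measurable_prodMk_left hE)) ?_ ?_, ← hΛ,
        hθreal (measurable_prodMk_left hE)]
      · rw [Finset.disjoint_left]
        intro i hi hi'
        obtain ⟨j, hj, rfl⟩ := Finset.mem_image.1 hi'
        exact hσs j hj hi
      · exact fun U U' h => hs a U U' h
      · refine fun U U' h => hs (φ a) _ _ fun i hi => ?_
        exact congrArg τ (h _ (Finset.mem_image_of_mem σ hi))
    have hrE : ∀ a, |r a - e a * e (φ a)| ≤ dd a + dd (φ a) := by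
      intro a
      rw [← hEE a]
      refine (abs_measureReal_sub_le_measureReal_symmDiff
        (measurable_prodMk_left hD).nullMeasurableSet
        ((measurable_prodMk_left hE).inter
          (hθ.measurable (measurable_prodMk_left hE))).nullMeasurableSet).trans ?_
      rw [hdd]
      simp only
      rw [← hθreal (S := Prod.mk (φ a) ⁻¹' (D ∆ E)) (measurable_prodMk_left hDEm)]
      refine (measureReal_mono ?_).trans (measureReal_union_le _ _)
      intro U hU
      have hiff := hinv a U
      simp only [Set.mem_symmDiff, Set.mem_union, Set.mem_preimage, Set.mem_inter_iff] at hU ⊢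
      change _ ∨ ((φ a, θ U) ∈ D ∧ _ ∨ _)
      change (φ a, θ U) ∈ D ↔ _ at hiff
      tauto
    -- One term `dd a + dd (φ a)` comes from `hrE`, the other from replacing `e a * e (φ a)` by `r a
    -- * r a`, using `r (φ a) = r a`.
    have hpt : ∀ a, r a - r a * r a ≤ 2 * (dd a + dd (φ a)) := by
      intro a
      have h1 := abs_le.1 (hrE a)
      have h2 := abs_le.1 (her a)
      have h3 := abs_le.1 (her (φ a))
      rw [hrφ] at h3
      have h4 : 0 ≤ e (φ a) := measureReal_nonneg
      have h5 : e (φ a) ≤ 1 := measureReal_le_one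
      have h6 : 0 ≤ dd a := measureReal_nonneg
      have h7 : 0 ≤ dd (φ a) := measureReal_nonneg
      nlinarith [hr0 a, hr1 a, mul_nonneg h4 h6, mul_nonneg (hr0 a) h7]
    have hddint : ∫ a, dd a ∂L ≤ ε := by
      rw [hdd]
      simp only [Measure.real]
      rw [integral_toReal (measurable_measure_prodMk_left hDEm).aemeasurable
        (Filter.Eventually.of_forall fun a => measure_lt_top _ _), ← Measure.prod_apply hDEm]
      exact ENNReal.toReal_le_of_le_ofReal hε.le hDE.le
    have hddφ : ∫ a, dd (φ a) ∂L = ∫ a, dd a ∂L := by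
      have := integral_map (μ := L) hφ.measurable.aemeasurable (f := dd)
        (hmeas hDEm).aestronglyMeasurable
      rw [← this, hφ.map_eq]
    calc ∫ a, (r a - r a * r a) ∂L ≤ ∫ a, 2 * (dd a + dd (φ a)) ∂L :=
          integral_mono hint2 (((hint hDEm).add
            (hφ.integrable_comp_of_integrable (hint hDEm))).const_mul 2) hpt
      _ = 2 * (∫ a, dd a ∂L + ∫ a, dd (φ a) ∂L) := by
          rw [integral_const_mul]
          exact congrArg _ (integral_add (hint hDEm)
            (hφ.integrable_comp_of_integrable (hint hDEm)))
      _ ≤ 4 * ε := by rw [hddφ]; linarith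
  have hzero : ∫ a, (r a - r a * r a) ∂L = 0 := by
    refine le_antisymm (le_of_forall_pos_le_add fun ε hε => ?_) (integral_nonneg hnn)
    have := hbound (ε / 4) (by positivity)
    linarith
  filter_upwards [(integral_eq_zero_iff_of_nonneg hnn hint2).1 hzero] with a ha
  have hfac : r a * (1 - r a) = 0 := by
    have : r a - r a * r a = 0 := ha
    linarith
  rcases mul_eq_zero.1 hfac with h | h
  · left
    simpa [hr, Measure.real, ENNReal.toReal_eq_zero_iff] using h
  · right
    have h1 : (Λ (Prod.mk a ⁻¹' D)).toReal = 1 := by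
      have : r a = 1 := by linarith
      exact this
    rwa [ENNReal.toReal_eq_one_iff] at h1

end ZeroOne

/-! ### Measurability of reachability, clusters, visits and walks. -/

section Measurability

theorem measurable_pop {V 𝒰 : Type*} [MeasurableSpace 𝒰] [DecidableEq V] (x : V) :
    Measurable (pop x : (V × ℕ → 𝒰) → V × ℕ → 𝒰) := by
  refine measurable_pi_lambda _ fun c => ?_
  simp only [pop]
  split_ifs <;> fun_prop

variable {A V 𝒰 : Type*} [MeasurableSpace A] [Countable V]

theorem measurableSet_reflTransGen {r : A → V → V → Prop}
    (hr : ∀ x z, MeasurableSet {a | r a x z}) (x z : V) :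
    MeasurableSet {a | Relation.ReflTransGen (r a) x z} := by
  -- `R k z` collects the parameters for which `z` is reached from `x` in exactly `k` steps.
  let R : ℕ → V → Set A := fun k => Nat.rec (fun z => {_a | x = z})
    (fun _ Rk z => ⋃ y, Rk y ∩ {a | r a y z}) k
  have hR : ∀ k z, MeasurableSet (R k z) := by
    intro k
    induction k with
    | zero => exact fun z => MeasurableSet.const _
    | succ k ih => exact fun z => MeasurableSet.iUnion fun y => (ih y).inter (hr y z)
  have : {a | Relation.ReflTransGen (r a) x z} = ⋃ k, R k z := by
    ext a
    rw [Set.mem_iUnion]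
    constructor
    · intro h
      induction h with
      | refl => exact ⟨0, rfl⟩
      | @tail b c _ hbc ih =>
        obtain ⟨k, hk⟩ := ih
        exact ⟨k + 1, Set.mem_iUnion.2 ⟨b, hk, hbc⟩⟩
    · rintro ⟨k, hk⟩
      induction k generalizing z with
      | zero =>
        have : x = z := hk
        subst this
        exact Relation.ReflTransGen.refl
      | succ k ih =>
        obtain ⟨y, hy, hyz⟩ := Set.mem_iUnion.1 hk
        exact Relation.ReflTransGen.tail (ih y hy) hyz
  rw [this]
  exact MeasurableSet.iUnion fun k => hR k z

theorem measurableSet_cluster_infinite {p : A → V → V → ℝ}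
    (hp : ∀ x z, Measurable fun a => p a x z) (v : V) :
    MeasurableSet {a | (cluster (p a) v).Infinite} := by
  have hr : ∀ x z, MeasurableSet {a | CanReach (p a) x z} :=
    measurableSet_reflTransGen fun x z => measurableSet_lt measurable_const (hp x z)
  exact measurableSet_infinite fun y => (hr v y).inter (hr y v)

variable [MeasurableSpace V] [DiscreteMeasurableSpace V]

theorem measurableSet_visits {n : A → V → ℕ} {s : A → ℕ → V → ℕ+ → V}
    (hn : ∀ x, Measurable fun a => n a x) (hs : ∀ j x i, Measurable fun a => s a j x i) (x z : V) :
    MeasurableSet {a | Visits (n a) (s a) x z} := by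
  have : {a | Visits (n a) (s a) x z} =
      ⋃ i : ℕ+, {a | (i : ℕ) ≤ n a x} ∩ ⋃ j : ℕ, {a | s a j x i = z} := by
    ext a
    simp [Visits]
  rw [this]
  exact MeasurableSet.iUnion fun i => (measurableSet_le measurable_const (hn x)).inter
    (MeasurableSet.iUnion fun j => hs j x i (measurableSet_singleton z))

theorem measurableSet_awake {n : A → V → ℕ} {s : A → ℕ → V → ℕ+ → V}
    (hn : ∀ x, Measurable fun a => n a x) (hs : ∀ j x i, Measurable fun a => s a j x i) (v x : V) :
    MeasurableSet {a | x ∈ Awake (n a) (s a) v} :=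
  measurableSet_reflTransGen (measurableSet_visits hn hs) v x

theorem measurableSet_infVisits {n : A → V → ℕ} {s : A → ℕ → V → ℕ+ → V}
    (hn : ∀ x, Measurable fun a => n a x) (hs : ∀ j x i, Measurable fun a => s a j x i) (v y : V) :
    MeasurableSet {a | InfVisits (n a) (s a) v y} :=
  measurableSet_infinite fun x =>
    (measurableSet_awake hn hs v x).inter (measurableSet_visits hn hs x y)

variable [MeasurableSpace 𝒰] [DecidableEq V]

theorem measurable_walk {g : A → V → 𝒰 → V} (hg : ∀ x, Measurable fun p : A × 𝒰 => g p.1 x p.2)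
    (j : ℕ) : ∀ (x : V) {w : A → V × ℕ → 𝒰}, Measurable w →
      Measurable fun a => walk (g a) x (w a) j := by
  induction j with
  | zero => exact fun x w _ => measurable_const
  | succ j ih =>
    intro x w hw
    have h1 : Measurable fun p : V × A => walk (g p.2) p.1 (pop x (w p.2)) j :=
      measurable_from_prod_countable_right fun y => ih y ((measurable_pop x).comp hw)
    have h2 : Measurable fun a => g a x (w a (x, 0)) :=
      (hg x).comp (measurable_id.prodMk ((measurable_pi_apply _).comp hw))
    exact h1.comp (h2.prodMk measurable_id)

theorem measurable_frogs {g : A → V → 𝒰 → V} (hg : ∀ x, Measurable fun p : A × 𝒰 => g p.1 x p.2)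
    {U : A → V × ℕ+ → V × ℕ → 𝒰} (hU : Measurable U) (j : ℕ) (x : V) (i : ℕ+) :
    Measurable fun a => frogs (g a) (U a) j x i :=
  measurable_walk hg j x ((measurable_pi_apply (x, i)).comp hU)

end Measurability

/-! ### Frogs in a fixed environment, driven by i.i.d. stacks. -/

section Quenched

open scoped ENNReal

variable {V 𝒰 : Type*}

section Push

variable [DecidableEq V]

/-- Put `u` on top of the stack at `x`. -/
def push (x : V) (p : (V × ℕ → 𝒰) × 𝒰) : V × ℕ → 𝒰 :=
  fun c => if c = (x, 0) then p.2 else p.1 (if c.1 = x then (x, c.2 - 1) else c)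

theorem push_apply_self (x : V) (p : (V × ℕ → 𝒰) × 𝒰) : push x p (x, 0) = p.2 := by
  simp [push]

theorem pop_push (x : V) (p : (V × ℕ → 𝒰) × 𝒰) : pop x (push x p) = p.1 := by
  funext c
  obtain ⟨y, k⟩ := c
  by_cases h : y = x
  · subst h
    simp [pop, push]
  · simp [pop, push, h]

end Push

variable [MeasurableSpace 𝒰]

/-- The law of i.i.d. stacks. -/
def stackLaw (V : Type*) (ν : Measure 𝒰) : Measure (V × ℕ → 𝒰) := Measure.infinitePi fun _ => ν

/-- The law of the stacks of all frogs. -/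
def frogLaw (V : Type*) (ν : Measure 𝒰) : Measure (V × ℕ+ → V × ℕ → 𝒰) :=
  Measure.infinitePi fun _ => stackLaw V ν

variable (ν : Measure 𝒰) [IsProbabilityMeasure ν]

instance : IsProbabilityMeasure (stackLaw V ν) :=
  inferInstanceAs (IsProbabilityMeasure (Measure.infinitePi _))

instance : IsProbabilityMeasure (frogLaw V ν) :=
  inferInstanceAs (IsProbabilityMeasure (Measure.infinitePi _))

theorem measurePreserving_replace {ι : Type*} [DecidableEq ι] (o : ι) :
    MeasurePreserving (fun (p : (ι → 𝒰) × 𝒰) c => if c = o then p.2 else p.1 c)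
      ((Measure.infinitePi fun _ : ι => ν).prod ν) (Measure.infinitePi fun _ : ι => ν) := by
  refine ⟨?_, map_insert_infinitePi ν id o (Set.injOn_id _)⟩
  refine measurable_pi_lambda _ fun c => ?_
  split_ifs <;> fun_prop

/-- There are countably many possible targets, so almost surely no entry selects a step of
probability zero. -/
theorem ae_step_pos [Countable V] {g : V → 𝒰 → V} :
    ∀ᵐ U ∂frogLaw V ν, ∀ f c, ν {u | g c.1 u = g c.1 (U f c)} ≠ 0 := by
  refine ae_all_iff.2 fun f => ae_all_iff.2 fun c => ?_
  have hmp : MeasurePreserving (fun U : V × ℕ+ → V × ℕ → 𝒰 => U f c) (frogLaw V ν) ν :=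
    (measurePreserving_eval_infinitePi (fun _ : V × ℕ => ν) c).comp
      (measurePreserving_eval_infinitePi (fun _ : V × ℕ+ => stackLaw V ν) f)
  refine hmp.quasiMeasurePreserving.ae (p := fun t => ν {u | g c.1 u = g c.1 t} ≠ 0) ?_
  have : ∀ z, ∀ᵐ t ∂ν, g c.1 t = z → ν {u | g c.1 u = z} ≠ 0 := by
    intro z
    by_cases h : ν {u | g c.1 u = z} = 0
    · filter_upwards [measure_eq_zero_iff_ae_notMem.1 h] with t ht ht'
      exact absurd ht' ht
    · exact Filter.Eventually.of_forall fun _ _ => h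
  filter_upwards [ae_all_iff.2 this] with t ht
  exact ht _ rfl

variable [DecidableEq V]

/-- The probability that the walk started at `x` hits `R`. -/
def hit (ν : Measure 𝒰) (g : V → 𝒰 → V) (R : Set V) (x : V) : ℝ≥0∞ :=
  stackLaw V ν {w | ∃ j, walk g x w j ∈ R}

theorem hit_le_one (g : V → 𝒰 → V) (R : Set V) (x : V) : hit ν g R x ≤ 1 := prob_le_one

theorem hit_of_mem (g : V → 𝒰 → V) {R : Set V} {x : V} (hx : x ∈ R) : hit ν g R x = 1 := by
  have : {w : V × ℕ → 𝒰 | ∃ j, walk g x w j ∈ R} = Set.univ :=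
    Set.eq_univ_of_forall fun w => ⟨0, hx⟩
  rw [hit, this, measure_univ]

theorem measurePreserving_push (x : V) :
    MeasurePreserving (push x) ((stackLaw V ν).prod ν) (stackLaw V ν) := by
  refine ⟨?_, map_insert_infinitePi ν _ (x, 0) ?_⟩
  · refine measurable_pi_lambda _ fun c => ?_
    simp only [push]
    split_ifs <;> fun_prop
  · rintro ⟨y, k⟩ hy ⟨y', k'⟩ hy' h
    simp only [Set.mem_compl_iff, Set.mem_singleton_iff, Prod.mk.injEq, not_and] at hy hy'
    change (if y = x then (x, k - 1) else (y, k)) = if y' = x then (x, k' - 1) else (y', k') at h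
    split_ifs at h with h1 h2 h2
    · have := hy h1
      have := hy' h2
      simp only [Prod.mk.injEq, true_and] at h
      ext
      · rw [h1, h2]
      · simp only; omega
    · simp only [Prod.mk.injEq] at h
      exact absurd h.1.symm h2
    · simp only [Prod.mk.injEq] at h
      exact absurd h.1 h1
    · exact h

variable [Countable V] [MeasurableSpace V] [DiscreteMeasurableSpace V]

theorem measurable_walk_of {g : V → 𝒰 → V} (hg : ∀ x, Measurable (g x)) (x : V) (j : ℕ) :
    Measurable fun w => walk g x w j :=
  measurable_walk (A := V × ℕ → 𝒰) (g := fun _ => g) (fun y => (hg y).comp measurable_snd) j x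
    measurable_id

theorem stackLaw_walk {g : V → 𝒰 → V} (hg : ∀ x, Measurable (g x)) (m : ℕ) :
    ∀ (x : V) (a : ℕ → V), stackLaw V ν {w | ∀ j ≤ m, walk g x w j = a j} =
      (if a 0 = x then 1 else 0) * ∏ j ∈ Finset.range m, ν {u | g (a j) u = a (j + 1)} := by
  have hms : ∀ m x (a : ℕ → V), MeasurableSet {w : V × ℕ → 𝒰 | ∀ j ≤ m, walk g x w j = a j} := by
    intro m x a
    have : {w : V × ℕ → 𝒰 | ∀ j ≤ m, walk g x w j = a j} =
        ⋂ j : ℕ, ⋂ _ : j ≤ m, {w | walk g x w j = a j} := by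
      ext w; simp
    rw [this]
    exact MeasurableSet.iInter fun j => MeasurableSet.iInter fun _ =>
      measurable_walk_of hg x j (measurableSet_singleton _)
  induction m with
  | zero =>
    intro x a
    by_cases h : a 0 = x
    · simp [walk, h]
    · simp [walk, h, Ne.symm h]
  | succ m ih =>
    intro x a
    by_cases h : a 0 = x
    -- Detaching the top entry at `x` is the Markov property: it chooses the first step, and the
    -- popped stacks are again i.i.d. and independent of it.
    · rw [← (measurePreserving_push ν x).measure_preimage (hms _ _ _).nullMeasurableSet]
      have : push x ⁻¹' {w | ∀ j ≤ m + 1, walk g x w j = a j} =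
          {w | ∀ j ≤ m, walk g (a 1) w j = a (j + 1)} ×ˢ {u | g x u = a 1} := by
        ext ⟨w, u⟩
        simp only [Set.mem_preimage, Set.mem_ofPred_eq, Set.mem_prod]
        constructor
        · intro hw
          have h1 := hw 1 (by omega)
          rw [walk, walk, push_apply_self] at h1
          refine ⟨fun j hj => ?_, h1⟩
          have := hw (j + 1) (by omega)
          rwa [walk, push_apply_self, pop_push, h1] at this
        · rintro ⟨h1, h2⟩ j hj
          cases j with
          | zero => rw [walk, h]
          | succ j =>
            rw [walk, push_apply_self, pop_push, h2]
            exact h1 j (by omega)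
      rw [this, Measure.prod_prod, ih (a 1) fun j => a (j + 1), Finset.prod_range_succ', h]
      simp
    · have : {w : V × ℕ → 𝒰 | ∀ j ≤ m + 1, walk g x w j = a j} = ∅ := by
        ext w
        simp only [Set.mem_ofPred_eq, Set.mem_empty_iff_false, iff_false, not_forall]
        exact ⟨0, by omega, fun hw => h hw.symm⟩
      rw [this]
      simp [h]

theorem measurableSet_hit {g : V → 𝒰 → V} (hg : ∀ x, Measurable (g x)) (R : Set V) (x : V) :
    MeasurableSet {w : V × ℕ → 𝒰 | ∃ j, walk g x w j ∈ R} := by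
  have : {w : V × ℕ → 𝒰 | ∃ j, walk g x w j ∈ R} = ⋃ j, (fun w => walk g x w j) ⁻¹' R := by
    ext w; simp
  rw [this]
  exact MeasurableSet.iUnion fun j => measurable_walk_of hg x j (MeasurableSet.of_discrete)

/-- Superharmonicity by conditioning on the first step. Equality can fail only when the starting
point already lies in `R`. -/
theorem tsum_hit_le {g : V → 𝒰 → V} (hg : ∀ x, Measurable (g x)) (R : Set V) (x : V) :
    ∑' z, ν {u | g x u = z} * hit ν g R z ≤ hit ν g R x := by
  have hz : ∀ z, MeasurableSet
      ({w : V × ℕ → 𝒰 | ∃ j, walk g z w j ∈ R} ×ˢ {u | g x u = z}) := fun z =>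
    (measurableSet_hit hg R z).prod (hg x (measurableSet_singleton z))
  have hdisj : Pairwise (Function.onFun Disjoint fun z =>
      {w : V × ℕ → 𝒰 | ∃ j, walk g z w j ∈ R} ×ˢ {u | g x u = z}) := by
    intro z z' hne
    refine Set.disjoint_left.2 ?_
    rintro ⟨w, u⟩ ⟨-, h1⟩ ⟨-, h2⟩
    exact hne (Eq.trans (Eq.symm h1) h2)
  calc ∑' z, ν {u | g x u = z} * hit ν g R z
      = ∑' z, ((stackLaw V ν).prod ν)
          ({w : V × ℕ → 𝒰 | ∃ j, walk g z w j ∈ R} ×ˢ {u | g x u = z}) := by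
        refine tsum_congr fun z => ?_
        rw [Measure.prod_prod, mul_comm]
        rfl
    _ = ((stackLaw V ν).prod ν)
          (⋃ z, {w : V × ℕ → 𝒰 | ∃ j, walk g z w j ∈ R} ×ˢ {u | g x u = z}) :=
        (measure_iUnion hdisj hz).symm
    _ ≤ ((stackLaw V ν).prod ν) (push x ⁻¹' {w | ∃ j, walk g x w j ∈ R}) := by
        refine measure_mono ?_
        rintro ⟨w, u⟩ h
        obtain ⟨z, ⟨j, hj⟩, h2⟩ := Set.mem_iUnion.1 h
        refine ⟨j + 1, ?_⟩
        rw [walk, push_apply_self, pop_push]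
        have h3 : g x u = z := h2
        rw [h3]
        exact hj
    _ = hit ν g R x :=
        (measurePreserving_push ν x).measure_preimage (measurableSet_hit hg R x).nullMeasurableSet

theorem measurableSet_infVisits_frogs {n : V → ℕ} {g : V → 𝒰 → V} (hg : ∀ x, Measurable (g x))
    (v y : V) : MeasurableSet {U | InfVisits n (frogs g U) v y} :=
  measurableSet_infVisits (A := V × ℕ+ → V × ℕ → 𝒰) (n := fun _ => n) (s := fun U => frogs g U)
    (fun _ => measurable_const) (measurable_frogs (g := fun _ => g)
      (fun x => (hg x).comp measurable_snd) measurable_id) v y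

theorem measurableSet_visitors {n : V → ℕ} {g : V → 𝒰 → V} (hg : ∀ x, Measurable (g x))
    (v y : V) (f : V × ℕ+) : MeasurableSet {U | f ∈ visitors n g v y U} := by
  have h1 := measurableSet_awake (A := V × ℕ+ → V × ℕ → 𝒰) (n := fun _ => n)
    (s := fun U => frogs g U) (fun _ => measurable_const) (measurable_frogs (g := fun _ => g)
      (fun x => (hg x).comp measurable_snd) measurable_id) v f.1
  have h2 : MeasurableSet {U : V × ℕ+ → V × ℕ → 𝒰 | ∃ j, walk g f.1 (U f) j = y} := by
    have h : Measurable fun U : V × ℕ+ → V × ℕ → 𝒰 => U f := measurable_pi_apply f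
    exact h (measurableSet_hit (𝒰 := 𝒰) hg {y} f.1)
  exact h1.inter ((MeasurableSet.const _).inter h2)

/-- If infinitely many activated frogs visit `y`, then infinitely many of them move on to `z`. -/
theorem ae_infVisits_step {n : V → ℕ} {g : V → 𝒰 → V} (hg : ∀ x, Measurable (g x)) (v y z : V)
    (hz : ν {u | g y u = z} ≠ 0) :
    ∀ᵐ U ∂frogLaw V ν, InfVisits n (frogs g U) v y → InfVisits n (frogs g U) v z := by
  have hJ : MeasurableSet {u | g y u = z} := hg y (measurableSet_singleton z)
  have hrep := measurePreserving_replace (ι := V × ℕ) ν (y, 0)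
  -- Resample, for every frog, only the entry used at its first visit of `y`. With all other entries
  -- fixed, these fresh variables are i.i.d. over the frogs.
  have hmix := map_combine_infinitePi (ι := V × ℕ+) (stackLaw V ν) ν (stackLaw V ν) _
    hrep.measurable hrep.map_eq
  set mix : (V × ℕ+ → V × ℕ → 𝒰) × (V × ℕ+ → 𝒰) → V × ℕ+ → V × ℕ → 𝒰 :=
    fun p f c => if c = (y, 0) then p.2 f else p.1 f c
  have hmixm : Measurable mix := by
    refine measurable_pi_lambda _ fun f => measurable_pi_lambda _ fun c => ?_
    simp only [mix]
    split_ifs <;> fun_prop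
  rw [frogLaw, ← hmix]
  refine (ae_map_iff hmixm.aemeasurable ?_).2 ?_
  · exact ((measurableSet_infVisits_frogs (n := n) hg v y).compl.union
      (measurableSet_infVisits_frogs (n := n) hg v z)).congr (by ext u; simp [imp_iff_not_or])
  have hv : ∀ f, MeasurableSet {p | f ∈ visitors n g v y (mix p)} := fun f =>
    hmixm (measurableSet_visitors hg v y f)
  have hae : ∀ᵐ p ∂(Measure.infinitePi fun _ : V × ℕ+ => stackLaw V ν).prod
      (Measure.infinitePi fun _ : V × ℕ+ => ν), (visitors n g v y (mix p)).Infinite →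
        {f | f ∈ visitors n g v y (mix p) ∧ p.2 f ∈ {u | g y u = z}}.Infinite := by
    generalize {u | g y u = z} = J at hJ hz
    refine (Measure.ae_prod_iff_ae_ae ?_).2 (Filter.Eventually.of_forall fun W => ?_)
    · have h1 := measurableSet_infinite hv
      have h2 := measurableSet_infinite (I := fun p : (V × ℕ+ → V × ℕ → 𝒰) × (V × ℕ+ → 𝒰) =>
        {f | f ∈ visitors n g v y (mix p) ∧ p.2 f ∈ J}) fun f =>
        (hv f).inter (((measurable_pi_apply f).comp measurable_snd) hJ)
      exact (h1.compl.union h2).congr (by ext u; simp [imp_iff_not_or])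
    · refine ae_infinite_inter_of_local ν hJ hz
        (I := fun T => visitors n g v y (mix (W, T))) (fun f => measurable_prodMk_left (hv f)) ?_
      intro T T' hTT
      refine visitors_congr (fun f c hc => ?_) fun f hf => ?_
      · have : c ≠ (y, 0) := fun h => hc (by rw [h])
        simp [mix, this]
      · simp only [mix, hTT f hf]
  filter_upwards [hae] with p hp hinf
  refine infVisits_of_infinite (hp (visitors_infinite hinf)) (fun f hf => hf.1.1)
    (fun f hf => hf.1.2.1) fun f hf => ?_
  obtain ⟨j, hj⟩ := hf.1.2.2
  obtain ⟨k, hk⟩ := walk_visits_next g y j f.1 _ hj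
  refine ⟨k, hk.trans ?_⟩
  have : mix p f (y, 0) = p.2 f := by simp [mix]
  change g y (mix p f (y, 0)) = z
  rw [this]
  exact hf.2

theorem ae_infVisits_of_reach {n : V → ℕ} {g : V → 𝒰 → V} (hg : ∀ x, Measurable (g x)) (v : V)
    {y z : V} (h : Relation.ReflTransGen (fun a b => ν {u | g a u = b} ≠ 0) y z) :
    ∀ᵐ U ∂frogLaw V ν, InfVisits n (frogs g U) v y → InfVisits n (frogs g U) v z := by
  induction h with
  | refl => exact Filter.Eventually.of_forall fun _ h => h
  | @tail b c _ hbc ih =>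
    filter_upwards [ih, ae_infVisits_step ν hg v b c hbc] with U h1 h2 h
    exact h2 (h1 h)

/-- If an independent walk from `v` almost surely hits a site from which there are
infinitely many visits at `v`, then `v` is almost surely recurrent. -/
theorem ae_infVisits_of_walk {n : V → ℕ} {g : V → 𝒰 → V} (hg : ∀ x, Measurable (g x)) (v : V)
    (hn : 1 ≤ n v)
    (h : ∀ᵐ U ∂frogLaw V ν, ∀ᵐ w ∂stackLaw V ν, ∃ j, InfVisits n (frogs g U) (walk g v w j) v) :
    ∀ᵐ U ∂frogLaw V ν, InfVisits n (frogs g U) v v := by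
  let o : V × ℕ+ := (v, 1)
  let E : (V × ℕ+ → V × ℕ → 𝒰) → (V × ℕ → 𝒰) → Prop := fun U w =>
    InfVisitsEx n (frogs g U) o (Set.range fun j => walk g v w j)
  have hmp := measurePreserving_replace (ι := V × ℕ+) (stackLaw V ν) o
  have h1 : ∀ᵐ U ∂frogLaw V ν, ∀ᵐ w ∂stackLaw V ν, E U w ∨ E U (U o) := by
    filter_upwards [h] with U hU
    filter_upwards [hU] with w ⟨j, hj⟩
    exact InfVisits.infVisitsEx (o := o) ⟨j, rfl⟩ hj
  have hE : ∀ U w w', E (fun c => if c = o then w' else U c) w ↔ E U w := fun U w w' =>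
    infVisitsEx_congr fun j x i hxi => by simp [frogs, hxi]
  have h2 := Measure.ae_ae_of_ae_prod (hmp.quasiMeasurePreserving.ae h1)
  -- `E` ignores the stack of `o`, so `w` and the stack `w'` of `o` play symmetric roles: for almost
  -- all pairs one of the two satisfies `E U`. If a non-null set of `w'` failed, a single such `w'`
  -- would force almost every `w` to succeed.
  have h3 : ∀ᵐ U ∂frogLaw V ν, ∀ᵐ w' ∂stackLaw V ν, E U w' := by
    filter_upwards [h2] with U hU
    by_contra hcon
    obtain ⟨w', hw', hnot⟩ := ((Filter.not_eventually.1 hcon).and_eventually hU).exists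
    simp only [hE, if_true] at hnot
    refine hcon ?_
    filter_upwards [hnot] with w hw
    exact hw.resolve_right hw'
  have h4 : ∀ᵐ p ∂(frogLaw V ν).prod (stackLaw V ν),
      InfVisits n (frogs g fun c => if c = o then p.2 else p.1 c) v v := by
    refine (Measure.ae_prod_iff_ae_ae
      (hmp.measurable (measurableSet_infVisits_frogs hg v v))).2 ?_
    filter_upwards [h3] with U hU
    filter_upwards [hU] with w' hw'
    refine InfVisitsEx.infVisits (o := o) (by exact_mod_cast hn) ?_
    have := (hE U w' w').2 hw'
    simpa [E, frogs, o] using this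
  have h5 := (ae_map_iff hmp.measurable.aemeasurable
    (measurableSet_infVisits_frogs (n := n) hg v v)).2 h4
  have h6 : ((frogLaw V ν).prod (stackLaw V ν)).map
      (fun p c => if c = o then p.2 else p.1 c) = frogLaw V ν := hmp.map_eq
  rwa [h6] at h5

end Quenched

/-! ### A shift-covariant realization of the steps by uniform variables. -/

section StepRule

open scoped ENNReal unitInterval

variable {d : ℕ}

/-- The law of the first step of the random walk started at the origin. -/
def stepKernel (d : ℕ) : Kernel (Env d) (Zd d) where
  toFun π := Measure.sum fun z : Zd d => ENNReal.ofReal (π.1 0 z) • Measure.dirac z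
  measurable' := by
    refine Measure.measurable_of_measurable_coe _ fun B hB => ?_
    simp only [Measure.sum_apply _ hB, Measure.smul_apply, smul_eq_mul]
    exact Measurable.tsum fun z => ((measurable_entry 0 z).ennreal_ofReal).mul measurable_const

theorem tsum_ofReal_entry (π : Env d) (x : Zd d) : ∑' z, ENNReal.ofReal (π.1 x z) = 1 := by
  rw [← ENNReal.ofReal_tsum_of_nonneg (fun z => (π.2.1 x z).1) (π.2.2 x).summable,
    (π.2.2 x).tsum_eq, ENNReal.ofReal_one]

theorem stepKernel_apply (π : Env d) (B : Set (Zd d)) (hB : MeasurableSet B) :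
    stepKernel d π B = ∑' z, ENNReal.ofReal (π.1 0 z) * B.indicator 1 z := by
  change (Measure.sum fun z : Zd d => ENNReal.ofReal (π.1 0 z) • Measure.dirac z) B = _
  simp only [Measure.sum_apply _ hB, Measure.smul_apply, smul_eq_mul, Measure.dirac_apply' _ hB]

instance : IsMarkovKernel (stepKernel d) :=
  ⟨fun π => ⟨by
    rw [stepKernel_apply _ _ MeasurableSet.univ]
    simpa using tsum_ofReal_entry π 0⟩⟩

theorem stepKernel_singleton (π : Env d) (z : Zd d) :
    stepKernel d π {z} = ENNReal.ofReal (π.1 0 z) := by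
  rw [stepKernel_apply _ _ (measurableSet_singleton z), tsum_eq_single z]
  · simp
  · intro y hy
    simp [hy]

/-- A rule that realizes the steps of random walks by uniform variables, consistently with
the shifts. -/
structure StepRule (d : ℕ) where
  /-- The next position. -/
  next : Env d → Zd d → I → Zd d
  measurable_next : ∀ x, Measurable fun p : Env d × I => next p.1 x p.2
  volume_next : ∀ π x z, volume {u | next π x u = z} = ENNReal.ofReal (π.1 x z)
  next_shift : ∀ π z x u, next (shiftEnv z π) (x - z) u = next π x u - z

theorem measurable_shiftEnv (z : Zd d) : Measurable (shiftEnv z : Env d → Env d) := by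
  refine Measurable.subtype_mk ?_
  exact measurable_pi_lambda _ fun x => measurable_pi_lambda _ fun y =>
    measurable_entry (x + z) (y + z)

instance : Nonempty (StepRule d) := by
  obtain ⟨f, hf, hmap⟩ := (stepKernel d).exists_measurable_map_eq_unitInterval
  -- Choosing every step as if from the origin of the environment seen from `x` makes the rule
  -- commute with the shifts.
  refine ⟨⟨fun π x u => x + f (shiftEnv x π) u, fun x => ?_, fun π x z => ?_, fun π z x u => ?_⟩⟩
  · refine measurable_const.add ?_
    exact hf.comp (((measurable_shiftEnv x).comp measurable_fst).prodMk measurable_snd)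
  · have hfm : Measurable (f (shiftEnv x π)) := hf.comp measurable_prodMk_left
    have : {u | x + f (shiftEnv x π) u = z} = f (shiftEnv x π) ⁻¹' {z - x} := by
      ext u
      simp only [Set.mem_ofPred_eq, Set.mem_preimage, Set.mem_singleton_iff, eq_sub_iff_add_eq']
    rw [this, ← Measure.map_apply hfm (measurableSet_singleton _), hmap, stepKernel_singleton]
    simp [shiftEnv]
  · have : shiftEnv (x - z) (shiftEnv z π) = shiftEnv x π := by
      refine Subtype.ext ?_
      funext a b
      simp [shiftEnv, add_assoc]
    simp only [this]
    abel

theorem StepRule.measurable (G : StepRule d) (π : Env d) (x : Zd d) : Measurable (G.next π x) :=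
  (G.measurable_next x).comp measurable_prodMk_left

theorem StepRule.measurable_aug (G : StepRule d) {A : Type*} [MeasurableSpace A]
    {p : A → AugEnv d} (hp : Measurable p) (x : Zd d) :
    Measurable fun q : A × I => G.next (p q.1).2 x q.2 :=
  (G.measurable_next x).comp
    ((measurable_snd.comp (hp.comp measurable_fst)).prodMk measurable_snd)

theorem StepRule.volume_next_ne_zero (G : StepRule d) (π : Env d) (x z : Zd d) :
    volume {u | G.next π x u = z} ≠ 0 ↔ 0 < π.1 x z := by
  rw [G.volume_next, Ne, ENNReal.ofReal_eq_zero, not_le]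

end StepRule

/-! ### Identification of the law of the frogs with the stack construction. -/

section Law

open scoped ENNReal unitInterval

variable {d : ℕ}

/-- The frogs of `f ∈ F` follow the paths `a f` during the first `m` steps. -/
def pathCylinder (F : Finset (Zd d × ℕ+)) (m : ℕ) (a : Zd d × ℕ+ → ℕ → Zd d) :
    Set (ℕ → Zd d → ℕ+ → Zd d) :=
  {s | ∀ f ∈ F, ∀ j ≤ m, s j f.1 f.2 = a f j}

theorem measurableSet_pathCylinder (F : Finset (Zd d × ℕ+)) (m : ℕ) (a : Zd d × ℕ+ → ℕ → Zd d) :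
    MeasurableSet (pathCylinder F m a) := by
  have : pathCylinder F m a = ⋂ f : F, ⋂ j : ℕ, ⋂ _ : j ≤ m, {s | s j f.1.1 f.1.2 = a f j} := by
    ext s
    simp [pathCylinder]
  rw [this]
  refine MeasurableSet.iInter fun f => MeasurableSet.iInter fun j => MeasurableSet.iInter fun _ => ?_
  have h : Measurable fun s : ℕ → Zd d → ℕ+ → Zd d => s j f.1.1 f.1.2 := by fun_prop
  exact h (measurableSet_singleton _)

/-- Finite measures on families of paths agree if they agree on path cylinders. -/
theorem ext_of_pathCylinder {M N : Measure (ℕ → Zd d → ℕ+ → Zd d)} [IsFiniteMeasure M]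
    (h : ∀ F m a, M (pathCylinder F m a) = N (pathCylinder F m a)) : M = N := by
  classical
  obtain ⟨e, he⟩ := exists_surjective_nat (Zd d × ℕ+)
  -- Letting frogs and time horizon grow together along one index makes two cylinders either
  -- disjoint or nested, which yields a π-system.
  let J : ℕ → Finset (Zd d × ℕ+) := fun m => (Finset.range m).image e
  have hJ : Monotone J := fun m m' hm =>
    Finset.image_subset_image (Finset.range_mono hm)
  let C : Set (Set (ℕ → Zd d → ℕ+ → Zd d)) := {B | ∃ m a, B = pathCylinder (J m) m a}
  have hpi : IsPiSystem C := by
    have aux : ∀ m m' (a a' : Zd d × ℕ+ → ℕ → Zd d), m ≤ m' →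
        (pathCylinder (J m) m a ∩ pathCylinder (J m') m' a').Nonempty →
        pathCylinder (J m) m a ∩ pathCylinder (J m') m' a' = pathCylinder (J m') m' a' := by
      rintro m m' a a' hm ⟨s, hs, hs'⟩
      refine Set.inter_eq_right.2 fun t ht f hf j hj => ?_
      exact (ht f (hJ hm hf) j (hj.trans hm)).trans
        ((hs' f (hJ hm hf) j (hj.trans hm)).symm.trans (hs f hf j hj))
    rintro _ ⟨m, a, rfl⟩ _ ⟨m', a', rfl⟩ hne
    rcases le_total m m' with hm | hm
    · exact ⟨m', a', aux m m' a a' hm hne⟩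
    · rw [Set.inter_comm] at hne ⊢
      exact ⟨m, a, aux m' m a' a hm hne⟩
  refine ext_of_generate_finite C ?_ hpi ?_ ?_
  · refine le_antisymm ?_ (MeasurableSpace.generateFrom_le ?_)
    · have hcoord : ∀ j x i, @Measurable _ _ (MeasurableSpace.generateFrom C) _
          (fun s : ℕ → Zd d → ℕ+ → Zd d => s j x i) := by
        intro j x i
        refine @measurable_to_countable' _ _ _ _ (_) _ fun v => ?_
        obtain ⟨k, hk⟩ := he (x, i)
        let m := max (k + 1) j
        have hmem : (x, i) ∈ J m := Finset.mem_image.2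
          ⟨k, Finset.mem_range.2 (lt_of_lt_of_le (Nat.lt_succ_self k) (le_max_left _ _)), hk⟩
        -- A cylinder only sees the finite window, so any default outside it will do; with finite
        -- windows the union below is countable.
        let ext : ((J m) × Fin (m + 1) → Zd d) → Zd d × ℕ+ → ℕ → Zd d := fun b f l =>
          if hf : f ∈ J m ∧ l < m + 1 then b (⟨f, hf.1⟩, ⟨l, hf.2⟩) else 0
        have : (fun s : ℕ → Zd d → ℕ+ → Zd d => s j x i) ⁻¹' {v} =
            ⋃ b : {b : (J m) × Fin (m + 1) → Zd d // ext b (x, i) j = v},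
              pathCylinder (J m) m (ext b) := by
          ext s
          simp only [Set.mem_preimage, Set.mem_singleton_iff, Set.mem_iUnion]
          constructor
          · intro hs
            have hb : ∀ f ∈ J m, ∀ l ≤ m,
                ext (fun c => s c.2 c.1.1.1 c.1.1.2) f l = s l f.1 f.2 := by
              intro f hf l hl
              simp only [ext]
              rw [dif_pos ⟨hf, Nat.lt_succ_of_le hl⟩]
            refine ⟨⟨fun c => s c.2 c.1.1.1 c.1.1.2, ?_⟩, fun f hf l hl => (hb f hf l hl).symm⟩
            rw [hb _ hmem j (le_max_right _ _)]
            exact hs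
          · rintro ⟨b, hs⟩
            exact (hs (x, i) hmem j (le_max_right _ _)).trans b.2
        rw [this]
        exact MeasurableSet.iUnion fun b =>
          MeasurableSpace.measurableSet_generateFrom ⟨m, ext b, rfl⟩
      have : @Measurable _ _ (MeasurableSpace.generateFrom C) _
          (fun s : ℕ → Zd d → ℕ+ → Zd d => s) :=
        @measurable_pi_lambda _ _ _ (_) _ _ fun j => @measurable_pi_lambda _ _ _ (_) _ _ fun x =>
          @measurable_pi_lambda _ _ _ (_) _ _ fun i => hcoord j x i
      exact fun B hB => this hB
    · rintro _ ⟨m, a, rfl⟩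
      exact measurableSet_pathCylinder _ _ _
  · rintro _ ⟨m, a, rfl⟩
    exact h _ _ _
  · have : pathCylinder (J 0) 0 (fun _ _ => (0 : Zd d)) = Set.univ := by
      refine Set.eq_univ_of_forall fun s f hf => ?_
      simp [J] at hf
    rw [← this]
    exact h _ _ _

theorem ofReal_pathProb (π : Env d) (x : Zd d) (a : ℕ → Zd d) (m : ℕ) :
    ENNReal.ofReal (pathProb π x a m) =
      (if a 0 = x then 1 else 0) * ∏ j ∈ Finset.range m, ENNReal.ofReal (π.1 (a j) (a (j + 1))) := by
  rw [pathProb, ENNReal.ofReal_mul (by split_ifs <;> norm_num),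
    ENNReal.ofReal_prod_of_nonneg fun j _ => (π.2.1 _ _).1]
  split_ifs <;> simp

theorem pathProb_nonneg (π : Env d) (x : Zd d) (a : ℕ → Zd d) (m : ℕ) : 0 ≤ pathProb π x a m :=
  mul_nonneg (by split_ifs <;> norm_num) (Finset.prod_nonneg fun j _ => (π.2.1 _ _).1)

theorem measurable_pathProb (x : Zd d) (a : ℕ → Zd d) (m : ℕ) :
    Measurable fun π : Env d => pathProb π x a m := by
  refine measurable_const.mul (Finset.measurable_prod _ fun j _ => ?_)
  exact measurable_entry _ _

theorem frogLaw_pathCylinder (G : StepRule d) (π : Env d) (F : Finset (Zd d × ℕ+)) (m : ℕ)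
    (a : Zd d × ℕ+ → ℕ → Zd d) :
    frogLaw (Zd d) (volume : Measure I) {U | frogs (G.next π) U ∈ pathCylinder F m a} =
      ∏ f ∈ F, ENNReal.ofReal (pathProb π f.1 (a f) m) := by
  have hbox : {U : Zd d × ℕ+ → Zd d × ℕ → I | frogs (G.next π) U ∈ pathCylinder F m a} =
      (F : Set (Zd d × ℕ+)).pi fun f => {w | ∀ j ≤ m, walk (G.next π) f.1 w j = a f j} := rfl
  have hms : ∀ f : Zd d × ℕ+, MeasurableSet
      {w : Zd d × ℕ → I | ∀ j ≤ m, walk (G.next π) f.1 w j = a f j} := by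
    intro f
    have : {w : Zd d × ℕ → I | ∀ j ≤ m, walk (G.next π) f.1 w j = a f j} =
        ⋂ j : ℕ, ⋂ _ : j ≤ m, {w | walk (G.next π) f.1 w j = a f j} := by
      ext w; simp
    rw [this]
    exact MeasurableSet.iInter fun j => MeasurableSet.iInter fun _ =>
      measurable_walk_of (G.measurable π) f.1 j (measurableSet_singleton _)
  rw [hbox, frogLaw, Measure.infinitePi_pi _ fun f _ => hms f]
  refine Finset.prod_congr rfl fun f _ => ?_
  rw [stackLaw_walk _ (G.measurable π), ofReal_pathProb]
  simp only [G.volume_next]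

variable {Ω : Type*} [MeasurableSpace Ω]

/-- The environment and the frogs can be realized by driving the frogs with i.i.d. uniform
variables that are independent of the environment. -/
theorem map_env_paths_eq (G : StepRule d) (μ : Measure Ω) [IsProbabilityMeasure μ]
    {η : Ω → Zd d → ℕ} (hη : Measurable η) {κ : Ω → Env d} (hκ : Measurable κ)
    {S : Ω → ℕ → Zd d → ℕ+ → Zd d} (hS : Measurable S) (hwalks : IndepWalksGiven μ η κ S) :
    μ.map (fun ω => (((η ω, κ ω) : AugEnv d), S ω)) =
      ((μ.map fun ω => ((η ω, κ ω) : AugEnv d)).prod (frogLaw (Zd d) (volume : Measure I))).map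
        fun q => (q.1, frogs (G.next q.1.2) q.2) := by
  have hκη : Measurable fun ω => ((η ω, κ ω) : AugEnv d) := hη.prodMk hκ
  set L := μ.map fun ω => ((η ω, κ ω) : AugEnv d) with hL
  have : IsProbabilityMeasure L := Measure.isProbabilityMeasure_map hκη.aemeasurable
  set Λ := frogLaw (Zd d) (volume : Measure I)
  have hfr : Measurable fun q : AugEnv d × (Zd d × ℕ+ → Zd d × ℕ → I) =>
      frogs (G.next q.1.2) q.2 := by
    refine measurable_pi_lambda _ fun j => measurable_pi_lambda _ fun x =>
      measurable_pi_lambda _ fun i => ?_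
    exact measurable_frogs (g := fun q : AugEnv d × (Zd d × ℕ+ → Zd d × ℕ → I) => G.next q.1.2)
      (G.measurable_aug measurable_fst) measurable_snd j x i
  have hΦ : Measurable fun q : AugEnv d × (Zd d × ℕ+ → Zd d × ℕ → I) =>
      (q.1, frogs (G.next q.1.2) q.2) := measurable_fst.prodMk hfr
  have hX : Measurable fun ω => (((η ω, κ ω) : AugEnv d), S ω) := hκη.prodMk hS
  have hfin : IsProbabilityMeasure (μ.map fun ω => (((η ω, κ ω) : AugEnv d), S ω)) :=
    Measure.isProbabilityMeasure_map hX.aemeasurable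
  refine Measure.ext_prod fun {A B} hA hB => ?_
  -- For a fixed environment event `A`, the two induced path measures are finite and need only be
  -- compared on cylinders, where the conditional expectation in `hwalks` gives the value.
  have key : ((μ.map fun ω => (((η ω, κ ω) : AugEnv d), S ω)).restrict (A ×ˢ Set.univ)).map Prod.snd
      = (((L.prod Λ).map fun q => (q.1, frogs (G.next q.1.2) q.2)).restrict
        (A ×ˢ Set.univ)).map Prod.snd := by
    refine ext_of_pathCylinder fun F m a => ?_
    have hcyl := measurableSet_pathCylinder F m a
    have hAu : MeasurableSet (A ×ˢ (Set.univ : Set (ℕ → Zd d → ℕ+ → Zd d))) :=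
      hA.prod MeasurableSet.univ
    rw [Measure.map_apply measurable_snd hcyl, Measure.map_apply measurable_snd hcyl,
      Measure.restrict_apply (measurable_snd hcyl), Measure.restrict_apply (measurable_snd hcyl),
      Measure.map_apply hX ((measurable_snd hcyl).inter hAu),
      Measure.map_apply hΦ ((measurable_snd hcyl).inter hAu)]
    set s : Set Ω := (fun ω => ((η ω, κ ω) : AugEnv d)) ⁻¹' A with hs
    have h1 : (fun ω => (((η ω, κ ω) : AugEnv d), S ω)) ⁻¹'
        (Prod.snd ⁻¹' pathCylinder F m a ∩ A ×ˢ Set.univ) = (S ⁻¹' pathCylinder F m a) ∩ s := by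
      ext ω
      simp [hs]
    have hprod0 : ∀ π : Env d, 0 ≤ ∏ f ∈ F, pathProb π f.1 (a f) m := fun π =>
      Finset.prod_nonneg fun f _ => pathProb_nonneg _ _ _ _
    have hprodm : Measurable fun π : Env d => ∏ f ∈ F, pathProb π f.1 (a f) m :=
      Finset.measurable_prod _ fun f _ => measurable_pathProb _ _ _
    have hlhs : μ ((S ⁻¹' pathCylinder F m a) ∩ s) =
        ∫⁻ ω in s, ENNReal.ofReal (∏ f ∈ F, pathProb (κ ω) f.1 (a f) m) ∂μ := by
      have hm := hκη.comap_le
      have hC : MeasurableSet (S ⁻¹' pathCylinder F m a) := hS hcyl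
      have hint : Integrable ((S ⁻¹' pathCylinder F m a).indicator fun _ => (1 : ℝ)) μ :=
        (integrable_const (1 : ℝ)).indicator hC
      have hce := hwalks F m a
      have h2 : ∫ ω in s, ∏ f ∈ F, pathProb (κ ω) f.1 (a f) m ∂μ =
          μ.real ((S ⁻¹' pathCylinder F m a) ∩ s) := by
        have hse : ∫ ω in s, (condExp (MeasurableSpace.comap
            (fun ω => ((η ω, κ ω) : AugEnv d)) inferInstance) μ
            ((S ⁻¹' pathCylinder F m a).indicator fun _ => (1 : ℝ))) ω ∂μ =
            ∫ ω in s, (S ⁻¹' pathCylinder F m a).indicator (fun _ => (1 : ℝ)) ω ∂μ :=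
          setIntegral_condExp hm hint ⟨A, hA, rfl⟩
        rw [← integral_congr_ae (ae_restrict_of_ae hce)]
        refine hse.trans ?_
        rw [integral_indicator hC, integral_const, measureReal_restrict_apply_univ,
          measureReal_restrict_apply hC, smul_eq_mul, mul_one]
      have hintp : Integrable (fun ω => ∏ f ∈ F, pathProb (κ ω) f.1 (a f) m) (μ.restrict s) :=
        (integrable_condExp.congr hce).restrict
      rw [← ofReal_integral_eq_lintegral_ofReal hintp (Filter.Eventually.of_forall fun ω =>
        hprod0 _), h2, ofReal_measureReal]
    have hrhs : (L.prod Λ) ((fun q : AugEnv d × (Zd d × ℕ+ → Zd d × ℕ → I) =>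
        (q.1, frogs (G.next q.1.2) q.2)) ⁻¹' (Prod.snd ⁻¹' pathCylinder F m a ∩ A ×ˢ Set.univ)) =
        ∫⁻ p in A, ENNReal.ofReal (∏ f ∈ F, pathProb p.2 f.1 (a f) m) ∂L := by
      rw [Measure.prod_apply (hΦ ((measurable_snd hcyl).inter hAu)), ← lintegral_indicator hA]
      refine lintegral_congr fun p => ?_
      by_cases hp : p ∈ A
      · rw [Set.indicator_of_mem hp, ENNReal.ofReal_prod_of_nonneg fun f _ =>
          pathProb_nonneg _ _ _ _, ← frogLaw_pathCylinder G]
        refine congrArg _ ?_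
        ext U
        simp [hp]
      · rw [Set.indicator_of_notMem hp]
        refine measure_mono_null ?_ measure_empty
        rintro U ⟨-, h, -⟩
        exact hp h
    rw [h1, hlhs, hrhs, hL]
    exact (setLIntegral_map (f := fun p : AugEnv d =>
      ENNReal.ofReal (∏ f ∈ F, pathProb p.2 f.1 (a f) m)) hA
      (hprodm.comp measurable_snd).ennreal_ofReal hκη).symm
  have h3 := congrArg (fun M => M B) key
  simp only [Measure.map_apply measurable_snd hB,
    Measure.restrict_apply (measurable_snd hB)] at h3
  have h4 : Prod.snd ⁻¹' B ∩ A ×ˢ (Set.univ : Set (ℕ → Zd d → ℕ+ → Zd d)) = A ×ˢ B := by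
    ext q
    simp [and_comm]
  rwa [h4] at h3

end Law

/-! ### Shift covariance and harmonicity of the probability of hitting a recurrent site. -/

section Shift

open scoped ENNReal unitInterval

variable {d : ℕ}

/-- The shift of a stack. -/
def shiftStack (z : Zd d) (w : Zd d × ℕ → I) : Zd d × ℕ → I := fun c => w (c.1 + z, c.2)

/-- The shift of the stacks of all frogs. -/
def shiftStacks (z : Zd d) (U : Zd d × ℕ+ → Zd d × ℕ → I) : Zd d × ℕ+ → Zd d × ℕ → I :=
  fun f => shiftStack z (U (f.1 + z, f.2))

theorem injective_shift_index (z : Zd d) (α : Type*) :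
    Function.Injective fun c : Zd d × α => (c.1 + z, c.2) := by
  rintro ⟨x, i⟩ ⟨y, j⟩ h
  simpa using h

theorem measurePreserving_shiftStack (z : Zd d) :
    MeasurePreserving (shiftStack z) (stackLaw (Zd d) (volume : Measure I))
      (stackLaw (Zd d) (volume : Measure I)) :=
  ⟨measurable_pi_lambda _ fun _ => measurable_pi_apply _,
    Measure.map_infinitePi_infinitePi_of_inj (P := fun _ : Zd d × ℕ => (volume : Measure I))
      (injective_shift_index z ℕ)⟩

theorem measurePreserving_shiftStacks (z : Zd d) :
    MeasurePreserving (shiftStacks z) (frogLaw (Zd d) (volume : Measure I))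
      (frogLaw (Zd d) (volume : Measure I)) := by
  have h1 : MeasurePreserving
      (fun (U : Zd d × ℕ+ → Zd d × ℕ → I) f => U (f.1 + z, f.2))
      (frogLaw (Zd d) (volume : Measure I)) (frogLaw (Zd d) (volume : Measure I)) :=
    ⟨measurable_pi_lambda _ fun _ => measurable_pi_apply _,
      Measure.map_infinitePi_infinitePi_of_inj
        (P := fun _ : Zd d × ℕ+ => stackLaw (Zd d) (volume : Measure I))
        (injective_shift_index z ℕ+)⟩
  have h2 : MeasurePreserving
      (fun (U : Zd d × ℕ+ → Zd d × ℕ → I) f => shiftStack z (U f))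
      (frogLaw (Zd d) (volume : Measure I)) (frogLaw (Zd d) (volume : Measure I)) := by
    have hm := (measurePreserving_shiftStack z).measurable
    refine ⟨measurable_pi_lambda _ fun f => hm.comp (measurable_pi_apply f), ?_⟩
    rw [frogLaw, Measure.infinitePi_map_pi _ fun _ => hm]
    simp only [(measurePreserving_shiftStack z).map_eq]
  exact h2.comp h1

/-- The sites that are recurrent for the frogs driven by `U`. -/
def recSet (G : StepRule d) (p : AugEnv d) (U : Zd d × ℕ+ → Zd d × ℕ → I) : Set (Zd d) :=
  {y | InfVisits p.1 (frogs (G.next p.2) U) y y}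

theorem walk_shiftStack (G : StepRule d) (π : Env d) (z x : Zd d) (w : Zd d × ℕ → I) (j : ℕ) :
    walk (G.next (shiftEnv z π)) x (shiftStack z w) j = walk (G.next π) (x + z) w j - z := by
  have := walk_shift (Equiv.subRight z) (G.next π) (G.next (shiftEnv z π))
    (fun x u => G.next_shift π z x u) j (x + z) w (shiftStack z w) fun c => by
      simp [shiftStack]
  simpa using this

theorem mem_recSet_shift (G : StepRule d) (p : AugEnv d) (U : Zd d × ℕ+ → Zd d × ℕ → I)
    (z y : Zd d) : y ∈ recSet G (shiftAug z p) (shiftStacks z U) ↔ y + z ∈ recSet G p U := by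
  have := infVisits_shift (Equiv.subRight z) (n := p.1) (s := frogs (G.next p.2) U)
    (n' := (shiftAug z p).1) (s' := frogs (G.next (shiftAug z p).2) (shiftStacks z U))
    (fun x => by simp [shiftAug]) (fun j x i => by
      have := walk_shiftStack G p.2 z (x - z) (U (x - z + z, i)) j
      simp only [sub_add_cancel] at this
      simpa [frogs, shiftStacks, shiftAug] using this) (y + z) (y + z)
  simpa [recSet] using this

/-- The quenched probability that an independent walk from `x` hits a recurrent site. -/
def hitRec (G : StepRule d) (p : AugEnv d) (U : Zd d × ℕ+ → Zd d × ℕ → I) (x : Zd d) : ℝ≥0∞ :=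
  hit volume (G.next p.2) (recSet G p U) x

theorem hitRec_shift (G : StepRule d) (p : AugEnv d) (U : Zd d × ℕ+ → Zd d × ℕ → I)
    (z x : Zd d) : hitRec G (shiftAug z p) (shiftStacks z U) x = hitRec G p U (x + z) := by
  have hms := measurableSet_hit (G.measurable (shiftEnv z p.2))
    (recSet G (shiftAug z p) (shiftStacks z U)) x
  have h := (measurePreserving_shiftStack z).measure_preimage hms.nullMeasurableSet
  refine h.symm.trans (congrArg _ ?_)
  ext w
  simp only [Set.mem_preimage, Set.mem_ofPred_eq, mem_recSet_shift, walk_shiftStack,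
    sub_add_cancel]

theorem measurableSet_recSet (G : StepRule d) (y : Zd d) :
    MeasurableSet {q : AugEnv d × (Zd d × ℕ+ → Zd d × ℕ → I) | y ∈ recSet G q.1 q.2} :=
  measurableSet_infVisits (A := AugEnv d × (Zd d × ℕ+ → Zd d × ℕ → I)) (n := fun q => q.1.1)
    (s := fun q => frogs (G.next q.1.2) q.2)
    (fun x => (measurable_pi_apply x).comp (measurable_fst.comp measurable_fst))
    (measurable_frogs (g := fun q : AugEnv d × (Zd d × ℕ+ → Zd d × ℕ → I) => G.next q.1.2)
      (G.measurable_aug measurable_fst) measurable_snd) y y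

theorem measurable_hitRec (G : StepRule d) (x : Zd d) :
    Measurable fun q : AugEnv d × (Zd d × ℕ+ → Zd d × ℕ → I) => hitRec G q.1 q.2 x := by
  have hset : MeasurableSet {r : (AugEnv d × (Zd d × ℕ+ → Zd d × ℕ → I)) × (Zd d × ℕ → I) |
      ∃ j, walk (G.next r.1.1.2) x r.2 j ∈ recSet G r.1.1 r.1.2} := by
    have : {r : (AugEnv d × (Zd d × ℕ+ → Zd d × ℕ → I)) × (Zd d × ℕ → I) |
        ∃ j, walk (G.next r.1.1.2) x r.2 j ∈ recSet G r.1.1 r.1.2} =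
        ⋃ j : ℕ, ⋃ y : Zd d, {r | walk (G.next r.1.1.2) x r.2 j = y} ∩
          Prod.fst ⁻¹' {q | y ∈ recSet G q.1 q.2} := by
      ext r
      simp
    rw [this]
    refine MeasurableSet.iUnion fun j => MeasurableSet.iUnion fun y =>
      MeasurableSet.inter ?_ (measurable_fst (measurableSet_recSet G y))
    exact measurable_walk
      (g := fun r : (AugEnv d × (Zd d × ℕ+ → Zd d × ℕ → I)) × (Zd d × ℕ → I) => G.next r.1.1.2)
      (G.measurable_aug (measurable_fst.comp measurable_fst)) j x measurable_snd
      (measurableSet_singleton y)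
  exact measurable_measure_prodMk_left hset

theorem measurable_hitRec_right (G : StepRule d) (p : AugEnv d) (x : Zd d) :
    Measurable fun U : Zd d × ℕ+ → Zd d × ℕ → I => hitRec G p U x :=
  Measurable.of_uncurry_left (f := fun (p : AugEnv d) U => hitRec G p U x) (measurable_hitRec G x)

theorem tsum_hitRec_le (G : StepRule d) (p : AugEnv d) (U : Zd d × ℕ+ → Zd d × ℕ → I)
    (x : Zd d) : ∑' z, ENNReal.ofReal (p.2.1 x z) * hitRec G p U z ≤ hitRec G p U x := by
  have := tsum_hit_le volume (G.measurable p.2) (recSet G p U) x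
  simp only [G.volume_next] at this
  exact this

theorem lintegral_augKernel (p : AugEnv d) {f : AugEnv d → ℝ≥0∞} (hf : Measurable f) :
    ∫⁻ q, f q ∂(augKernel d p) = ∑' z, ENNReal.ofReal (p.2.1 0 z) * f (shiftAug z p) := by
  change ∫⁻ q, f q ∂(Measure.sum fun z : Zd d =>
    ENNReal.ofReal (p.2.1 0 z) • Measure.dirac (shiftAug z p)) = _
  rw [lintegral_sum_measure]
  refine tsum_congr fun z => ?_
  rw [lintegral_smul_measure, lintegral_dirac' _ hf, smul_eq_mul]

/-- With respect to an invariant measure of the environment viewed from the particle, the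
superharmonic function `hitRec` is harmonic at the origin. -/
theorem ae_hitRec_harmonic (G : StepRule d) (Pbar : Measure (AugEnv d)) [IsProbabilityMeasure Pbar]
    (hinv : (augKernel d).Invariant Pbar) :
    ∀ᵐ p ∂Pbar, ∀ᵐ U ∂frogLaw (Zd d) (volume : Measure I),
      ∑' z, ENNReal.ofReal (p.2.1 0 z) * hitRec G p U z = hitRec G p U 0 := by
  set Λ := frogLaw (Zd d) (volume : Measure I) with hΛ
  have hms : ∀ z : Zd d, Measurable fun q : AugEnv d × (Zd d × ℕ+ → Zd d × ℕ → I) =>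
      ENNReal.ofReal (q.1.2.1 0 z) * hitRec G q.1 q.2 z := fun z =>
    (((measurable_entry 0 z).comp (measurable_snd.comp measurable_fst)).ennreal_ofReal).mul
      (measurable_hitRec G z)
  have hm1 : Measurable fun q : AugEnv d × (Zd d × ℕ+ → Zd d × ℕ → I) =>
      ∑' z, ENNReal.ofReal (q.1.2.1 0 z) * hitRec G q.1 q.2 z := Measurable.tsum hms
  have hm0 := measurable_hitRec G (0 : Zd d)
  have hbar : Measurable fun p : AugEnv d => ∫⁻ U, hitRec G p U 0 ∂Λ := hm0.lintegral_prod_right'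
  -- After averaging over the stacks, evaluation at `z` is evaluation at 0 in the shifted
  -- environment; this turns the sum over first steps into an integral against `augKernel`.
  have hshift : ∀ (p : AugEnv d) (z : Zd d),
      ∫⁻ U, hitRec G p U z ∂Λ = ∫⁻ U, hitRec G (shiftAug z p) U 0 ∂Λ := by
    intro p z
    have h := (measurePreserving_shiftStacks z).lintegral_comp
      (f := fun U => hitRec G (shiftAug z p) U 0)
      (measurable_hitRec_right G _ 0)
    rw [← hΛ] at h
    rw [← h]
    refine lintegral_congr fun U => ?_
    rw [hitRec_shift, zero_add]
  have hint : ∫⁻ q, ∑' z, ENNReal.ofReal (q.1.2.1 0 z) * hitRec G q.1 q.2 z ∂(Pbar.prod Λ) =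
      ∫⁻ q, hitRec G q.1 q.2 0 ∂(Pbar.prod Λ) := by
    rw [lintegral_prod _ hm1.aemeasurable, lintegral_prod _ hm0.aemeasurable]
    have h1 : ∀ p : AugEnv d,
        ∫⁻ U, ∑' z, ENNReal.ofReal (p.2.1 0 z) * hitRec G p U z ∂Λ =
          ∫⁻ q, ∫⁻ U, hitRec G q U 0 ∂Λ ∂(augKernel d p) := by
      intro p
      rw [lintegral_augKernel p hbar]
      refine (lintegral_tsum fun z =>
        ((measurable_hitRec_right G p z).const_mul _).aemeasurable).trans ?_
      refine tsum_congr fun z => ?_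
      rw [← hshift]
      exact lintegral_const_mul _ (measurable_hitRec_right G p z)
    simp only [h1]
    rw [← Measure.lintegral_bind (augKernel d).measurable.aemeasurable hbar.aemeasurable, hinv.def]
  have hfin : ∫⁻ q, ∑' z, ENNReal.ofReal (q.1.2.1 0 z) * hitRec G q.1 q.2 z ∂(Pbar.prod Λ) ≠ ∞ := by
    rw [hint]
    refine ne_of_lt (lt_of_le_of_lt (lintegral_mono (g := fun _ => 1) fun q => hit_le_one _ _ _ _) ?_)
    simp
  -- A pointwise inequality between functions with equal finite integrals is an equality almost
  -- everywhere.
  have hae := ae_eq_of_ae_le_of_lintegral_le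
    (Filter.Eventually.of_forall fun q : AugEnv d × (Zd d × ℕ+ → Zd d × ℕ → I) =>
      tsum_hitRec_le G q.1 q.2 0) hfin hm0.aemeasurable hint.ge
  exact Measure.ae_ae_of_ae_prod hae

theorem canReach_shiftEnv (π : Env d) (z x y : Zd d) :
    CanReach (shiftEnv z π).1 x y ↔ CanReach π.1 (x + z) (y + z) := by
  constructor
  · intro h
    exact Relation.ReflTransGen.lift (r := fun a b => 0 < (shiftEnv z π).1 a b)
      (p := fun a b => 0 < π.1 a b) (· + z) (fun a b hab => hab) _ _ h
  · intro h
    have := Relation.ReflTransGen.lift (p := fun a b => 0 < (shiftEnv z π).1 a b)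
      (r := fun a b => 0 < π.1 a b) (· - z) (fun a b hab => by
        simpa [Function.onFun, shiftEnv] using hab) _ _ h
    simpa [CanReach, Function.onFun] using this

theorem cluster_shiftEnv_infinite (π : Env d) (z x : Zd d) :
    (cluster (shiftEnv z π).1 x).Infinite ↔ (cluster π.1 (x + z)).Infinite := by
  have : cluster (shiftEnv z π).1 x = (Equiv.addRight z) ⁻¹' cluster π.1 (x + z) := by
    ext y
    simp [cluster, canReach_shiftEnv]
  rw [this, ← Equiv.image_symm_eq_preimage,
    Set.infinite_image_iff (Equiv.addRight z).symm.injective.injOn]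

theorem cluster_eq_of_mem {V : Type*} {π : V → V → ℝ} {x y : V} (h : y ∈ cluster π x) :
    cluster π y = cluster π x := by
  ext z
  exact ⟨fun hz => ⟨h.1.trans hz.1, hz.2.trans h.2⟩, fun hz => ⟨h.2.trans hz.1, hz.2.trans h.1⟩⟩

/-- Harmonicity at `y` is harmonicity at 0 after shifting environment and stacks by `y`, and both
laws are shift invariant. -/
theorem ae_hitRec_harmonic_of_cluster (G : StepRule d) (L Pbar : Measure (AugEnv d))
    [IsProbabilityMeasure Pbar] (hinv : (augKernel d).Invariant Pbar)
    (hL : ∀ z, L.map (shiftAug z) = L)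
    (hac : L.restrict {p | (cluster p.2.1 0).Infinite} ≪ Pbar) :
    ∀ᵐ p ∂L, ∀ y, (cluster p.2.1 y).Infinite → ∀ᵐ U ∂frogLaw (Zd d) (volume : Measure I),
      ∑' z, ENNReal.ofReal (p.2.1 y z) * hitRec G p U z = hitRec G p U y := by
  have hC : MeasurableSet {p : AugEnv d | (cluster p.2.1 0).Infinite} :=
    measurableSet_cluster_infinite (p := fun p : AugEnv d => p.2.1)
      (fun x z => (measurable_entry x z).comp measurable_snd) 0
  have h0 := (ae_restrict_iff' hC).1 (hac.ae_le (ae_hitRec_harmonic G Pbar hinv))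
  refine ae_all_iff.2 fun y => ?_
  have hmp : MeasurePreserving (shiftAug y) L L := ⟨measurable_shiftAug y, hL y⟩
  filter_upwards [hmp.quasiMeasurePreserving.ae h0] with p hp hy
  have hy' : (cluster (shiftAug y p).2.1 0).Infinite := by
    have := cluster_shiftEnv_infinite p.2 y 0
    rw [zero_add] at this
    exact this.2 hy
  filter_upwards [(measurePreserving_shiftStacks y).quasiMeasurePreserving.ae (hp hy')] with U hU
  simp only [hitRec_shift, zero_add] at hU
  rw [← hU, ← (Equiv.addRight y).tsum_eq]
  refine tsum_congr fun z => ?_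
  simp [shiftAug, shiftEnv]

end Shift

/-! ### The dichotomy for the set of recurrent sites and its consequence in the infinite cluster. -/

section Lattice

open scoped ENNReal unitInterval

variable {d : ℕ}

theorem recSet_zero_one (hd : 1 ≤ d) (G : StepRule d) (L : Measure (AugEnv d))
    [IsProbabilityMeasure L] (hL : ∀ z, L.map (shiftAug z) = L)
    (hL_erg : ∀ B, MeasurableSet B → (∀ z, shiftAug z ⁻¹' B = B) → L B = 0 ∨ L B = 1) :
    (∀ᵐ p ∂L, ∀ᵐ U ∂frogLaw (Zd d) (volume : Measure I), ¬ (recSet G p U).Nonempty) ∨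
      ∀ᵐ p ∂L, ∀ᵐ U ∂frogLaw (Zd d) (volume : Measure I), (recSet G p U).Nonempty := by
  classical
  set Λ := frogLaw (Zd d) (volume : Measure I)
  set D : Set (AugEnv d × (Zd d × ℕ+ → Zd d × ℕ → I)) := {q | (recSet G q.1 q.2).Nonempty} with hDdef
  have hD : MeasurableSet D := by
    have : D = ⋃ y, {q | y ∈ recSet G q.1 q.2} := by
      ext q
      simp [hDdef, Set.Nonempty]
    rw [this]
    exact MeasurableSet.iUnion fun y => measurableSet_recSet G y
  have hDshift : ∀ z p U, (shiftAug z p, shiftStacks z U) ∈ D ↔ (p, U) ∈ D := by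
    intro z p U
    constructor
    · rintro ⟨y, hy⟩
      exact ⟨y + z, (mem_recSet_shift G p U z y).1 hy⟩
    · rintro ⟨y, hy⟩
      refine ⟨y - z, (mem_recSet_shift G p U z _).2 ?_⟩
      simpa using hy
  have : Nonempty (Fin d) := ⟨⟨0, hd⟩⟩
  have h01 : ∀ᵐ p ∂L, Λ (Prod.mk p ⁻¹' D) = 0 ∨ Λ (Prod.mk p ⁻¹' D) = 1 := by
    refine ae_measure_section_eq_zero_or_one L (stackLaw (Zd d) (volume : Measure I)) hD fun s => ?_
    -- A `z` that is not a difference of two sites occurring in `s` moves `s` off itself. It exists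
    -- because the lattice is infinite, `d` being positive.
    obtain ⟨z, hz⟩ := Infinite.exists_notMem_finset
      ((s ×ˢ s).image fun r => r.1.1 - r.2.1)
    refine ⟨shiftAug z, fun f => (f.1 + z, f.2), shiftStack z, ⟨measurable_shiftAug z, hL z⟩,
      injective_shift_index z ℕ+, measurePreserving_shiftStack z, fun f hf hf' => hz ?_,
      fun p U => hDshift z p U⟩
    refine Finset.mem_image.2 ⟨((f.1 + z, f.2), f), Finset.mem_product.2 ⟨hf', hf⟩, ?_⟩
    simp
  have hrm : Measurable fun p => Λ (Prod.mk p ⁻¹' D) := measurable_measure_prodMk_left hD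
  have hinv : ∀ z p, Λ (Prod.mk (shiftAug z p) ⁻¹' D) = Λ (Prod.mk p ⁻¹' D) := by
    intro z p
    rw [← (measurePreserving_shiftStacks z).measure_preimage
      (measurable_prodMk_left hD).nullMeasurableSet]
    refine congrArg _ ?_
    ext U
    exact hDshift z p U
  have hB : MeasurableSet {p | Λ (Prod.mk p ⁻¹' D) = 1} := hrm (measurableSet_singleton 1)
  rcases hL_erg {p | Λ (Prod.mk p ⁻¹' D) = 1} hB (fun z => by
    ext p
    simp only [Set.mem_preimage, Set.mem_ofPred_eq, hinv]) with h | h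
  · left
    filter_upwards [h01, measure_eq_zero_iff_ae_notMem.1 h] with p hp hp'
    exact measure_eq_zero_iff_ae_notMem.1 (hp.resolve_right hp')
  · right
    filter_upwards [(prob_compl_eq_zero_iff hB).2 h] with p hp
    exact (prob_compl_eq_zero_iff (measurable_prodMk_left hD)).2 hp

theorem eq_one_of_tsum_mul_eq_one {ι : Type*} {p f : ι → ℝ≥0∞} (hp : ∑' i, p i = 1)
    (hf : ∀ i, f i ≤ 1) (h : ∑' i, p i * f i = 1) {i : ι} (hi : p i ≠ 0) : f i = 1 := by
  by_contra hne
  have hlt : f i < 1 := lt_of_le_of_ne (hf i) hne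
  have hpi : p i ≠ ∞ := ne_top_of_le_ne_top ENNReal.one_ne_top (hp ▸ ENNReal.le_tsum i)
  have := ENNReal.tsum_lt_tsum (f := fun i => p i * f i) (g := p) (i := i)
    (by rw [h]; exact ENNReal.one_ne_top) (fun j => mul_le_of_le_one_right' (hf j)) (by
      calc p i * f i < p i * 1 := ENNReal.mul_lt_mul_right hi hpi hlt
        _ = p i := mul_one _)
  rw [h, hp] at this
  exact lt_irrefl _ this

/-- Maximum principle: where a harmonic function bounded by 1 attains 1, it is 1 at every site
reachable in one step. A path from `y` to a site of its cluster stays in the cluster, so harmonicity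
is available all along it. -/
theorem hitRec_eq_one_of_mem_cluster (G : StepRule d) {p : AugEnv d}
    {U : Zd d × ℕ+ → Zd d × ℕ → I} {y v : Zd d} (hy : (cluster p.2.1 y).Infinite)
    (hharm : ∀ x, (cluster p.2.1 x).Infinite →
      ∑' z, ENNReal.ofReal (p.2.1 x z) * hitRec G p U z = hitRec G p U x)
    (hy1 : hitRec G p U y = 1) (hv : v ∈ cluster p.2.1 y) : hitRec G p U v = 1 := by
  obtain ⟨h1, h2⟩ := hv
  induction h1 with
  | refl => exact hy1
  | @tail b c hb hbc ih =>
    have hby : CanReach p.2.1 b y := Relation.ReflTransGen.head hbc h2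
    have hb1 := ih hby
    have hbinf : (cluster p.2.1 b).Infinite := by
      rw [cluster_eq_of_mem (show b ∈ cluster p.2.1 y from ⟨hb, hby⟩)]
      exact hy
    refine eq_one_of_tsum_mul_eq_one (tsum_ofReal_entry p.2 b) (fun z => hit_le_one _ _ _ _)
      ((hharm b hbinf).trans hb1) (i := c) ?_
    rwa [Ne, ENNReal.ofReal_eq_zero, not_le]

/-- Without frogs at `v` nothing else is activated. Otherwise each of the infinitely many activated
sites whose frogs visit `v` communicates with `v` in both directions. -/
theorem InfVisits.cluster_infinite {n : Zd d → ℕ} {s : ℕ → Zd d → ℕ+ → Zd d} {π : Env d} {v : Zd d}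
    (hs : ∀ j x i, CanReach π.1 x (s j x i)) (h : InfVisits n s v v) :
    1 ≤ n v ∧ (cluster π.1 v).Infinite := by
  have hvis : ∀ x z, Visits n s x z → CanReach π.1 x z := by
    rintro x z ⟨i, -, j, rfl⟩
    exact hs j x i
  constructor
  · by_contra hn
    refine h ((Set.finite_singleton v).subset ?_)
    rintro x ⟨hx, -⟩
    rcases Relation.ReflTransGen.cases_head hx with h1 | ⟨c, ⟨i, hi, -⟩, -⟩
    · exact h1.symm
    · exact absurd (i.pos.trans_le hi) hn
  · have hA : ∀ x ∈ Awake n s v, CanReach π.1 v x := by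
      intro x hx
      induction hx with
      | refl => exact Relation.ReflTransGen.refl
      | tail _ hbc ih => exact Relation.ReflTransGen.trans ih (hvis _ _ hbc)
    exact h.mono fun x hx => ⟨hA x hx.1, hvis _ _ hx.2⟩

theorem ae_canReach_frogs (G : StepRule d) (π : Env d) :
    ∀ᵐ U ∂frogLaw (Zd d) (volume : Measure I),
      ∀ j x i, CanReach π.1 x (frogs (G.next π) U j x i) := by
  filter_upwards [ae_step_pos (V := Zd d) volume (g := G.next π)] with U hU j x i
  refine walk_reach (G.next π) (fun a b => 0 < π.1 a b) j x (U (x, i)) fun c => ?_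
  exact (G.volume_next_ne_zero π _ _).1 (hU (x, i) c)

/-- In an environment with a unique infinite cluster in which some site is almost surely recurrent
and hitting a recurrent site is harmonic, all occupied sites of the infinite cluster are recurrent. -/
theorem ae_mem_recSet (G : StepRule d) (p : AugEnv d)
    (hD : ∀ᵐ U ∂frogLaw (Zd d) (volume : Measure I), (recSet G p U).Nonempty)
    (hharm : ∀ y, (cluster p.2.1 y).Infinite → ∀ᵐ U ∂frogLaw (Zd d) (volume : Measure I),
      ∑' z, ENNReal.ofReal (p.2.1 y z) * hitRec G p U z = hitRec G p U y)
    (huniq : ∀ x y, (cluster p.2.1 x).Infinite → (cluster p.2.1 y).Infinite →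
      cluster p.2.1 x = cluster p.2.1 y)
    {v : Zd d} (hn : 1 ≤ p.1 v) (hv : (cluster p.2.1 v).Infinite) :
    ∀ᵐ U ∂frogLaw (Zd d) (volume : Measure I), v ∈ recSet G p U := by
  refine ae_infVisits_of_walk volume (G.measurable p.2) v hn ?_
  have hreach : ∀ᵐ U ∂frogLaw (Zd d) (volume : Measure I), ∀ y, CanReach p.2.1 y v →
      InfVisits p.1 (frogs (G.next p.2) U) y y → InfVisits p.1 (frogs (G.next p.2) U) y v := by
    refine ae_all_iff.2 fun y => ?_
    by_cases h : CanReach p.2.1 y v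
    · have h' : Relation.ReflTransGen
          (fun a b => (volume : Measure I) {u | G.next p.2 a u = b} ≠ 0) y v := by
        simp only [G.volume_next_ne_zero]
        exact h
      filter_upwards [ae_infVisits_of_reach volume (n := p.1) (G.measurable p.2) y h'] with U hU _
      exact hU
    · exact Filter.Eventually.of_forall fun _ h' => absurd h' h
  have hharm' : ∀ᵐ U ∂frogLaw (Zd d) (volume : Measure I), ∀ y, (cluster p.2.1 y).Infinite →
      ∑' z, ENNReal.ofReal (p.2.1 y z) * hitRec G p U z = hitRec G p U y := by
    refine ae_all_iff.2 fun y => ?_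
    by_cases h : (cluster p.2.1 y).Infinite
    · filter_upwards [hharm y h] with U hU _
      exact hU
    · exact Filter.Eventually.of_forall fun _ h' => absurd h' h
  filter_upwards [hD, hreach, hharm', ae_canReach_frogs G p.2] with U ⟨y, hy⟩ h1 h2 h3
  -- Recurrent sites have infinite clusters, so uniqueness places all of them in the cluster of `v`.
  have hrec : ∀ y ∈ recSet G p U, (cluster p.2.1 y).Infinite ∧ v ∈ cluster p.2.1 y := by
    intro y hy
    have hinf := (InfVisits.cluster_infinite h3 hy).2
    refine ⟨hinf, ?_⟩
    rw [huniq y v hinf hv]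
    exact ⟨.refl, .refl⟩
  have hhit : hitRec G p U v = 1 :=
    hitRec_eq_one_of_mem_cluster G (hrec y hy).1 h2 (hit_of_mem volume _ hy) (hrec y hy).2
  have hms := measurableSet_hit (G.measurable p.2) (recSet G p U) v
  have hae : ∀ᵐ w ∂stackLaw (Zd d) (volume : Measure I),
      ∃ j, walk (G.next p.2) v w j ∈ recSet G p U := (prob_compl_eq_zero_iff hms).2 hhit
  filter_upwards [hae] with w ⟨j, hj⟩
  exact ⟨j, h1 _ (hrec _ hj).2.1 hj⟩

theorem measure_recurrent_eq (G : StepRule d) {Ω : Type*} [MeasurableSpace Ω] (μ : Measure Ω)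
    [IsProbabilityMeasure μ] {η : Ω → Zd d → ℕ} (hη : Measurable η) {κ : Ω → Env d}
    (hκ : Measurable κ) {S : Ω → ℕ → Zd d → ℕ+ → Zd d} (hS : Measurable S)
    (hS0 : ∀ ω x i, S ω 0 x i = x) (hwalks : IndepWalksGiven μ η κ S) (v : Zd d) :
    μ {ω | Recurrent (η ω) (S ω) v} =
      ∫⁻ p, frogLaw (Zd d) (volume : Measure I) {U | v ∈ recSet G p U}
        ∂(μ.map fun ω => ((η ω, κ ω) : AugEnv d)) := by
  have hκη : Measurable fun ω => ((η ω, κ ω) : AugEnv d) := hη.prodMk hκ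
  have : IsProbabilityMeasure (μ.map fun ω => ((η ω, κ ω) : AugEnv d)) :=
    Measure.isProbabilityMeasure_map hκη.aemeasurable
  have hT : MeasurableSet {r : AugEnv d × (ℕ → Zd d → ℕ+ → Zd d) | InfVisits r.1.1 r.2 v v} :=
    measurableSet_infVisits (A := AugEnv d × (ℕ → Zd d → ℕ+ → Zd d)) (n := fun r => r.1.1)
      (s := fun r => r.2)
      (fun x => (measurable_pi_apply x).comp (measurable_fst.comp measurable_fst))
      (fun j x i => by fun_prop) v v
  have hfr : Measurable fun q : AugEnv d × (Zd d × ℕ+ → Zd d × ℕ → I) =>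
      (q.1, frogs (G.next q.1.2) q.2) := by
    refine measurable_fst.prodMk (measurable_pi_lambda _ fun j => measurable_pi_lambda _ fun x =>
      measurable_pi_lambda _ fun i => ?_)
    exact measurable_frogs (g := fun q : AugEnv d × (Zd d × ℕ+ → Zd d × ℕ → I) => G.next q.1.2)
      (G.measurable_aug measurable_fst) measurable_snd j x i
  have h1 : {ω | Recurrent (η ω) (S ω) v} = (fun ω => (((η ω, κ ω) : AugEnv d), S ω)) ⁻¹'
      {r : AugEnv d × (ℕ → Zd d → ℕ+ → Zd d) | InfVisits r.1.1 r.2 v v} := by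
    ext ω
    exact recurrent_iff (η ω) (S ω) (hS0 ω) v
  rw [h1, ← Measure.map_apply (hκη.prodMk hS) hT, map_env_paths_eq G μ hη hκ hS hwalks,
    Measure.map_apply hfr hT, Measure.prod_apply (hfr hT)]
  rfl

end Lattice

end FrogModel

end

/-! ### The zero-one law. -/

theorem theorem3 {d : ℕ} (hd : 1 ≤ d)
    {Ω : Type*} [MeasurableSpace Ω] (μ : Measure Ω) [IsProbabilityMeasure μ]
    (η : Ω → Zd d → ℕ) (hη : Measurable η)
    (κ : Ω → Env d) (hκ : Measurable κ)
    (S : Ω → ℕ → Zd d → ℕ+ → Zd d) (hS : Measurable S)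
    (hS0 : ∀ ω x i, S ω 0 x i = x)
    (hUC : UniqueInfiniteCluster μ κ)
    (hinf : 0 < μ {ω | (cluster (κ ω).1 0).Infinite})
    (hstat : Stationary μ (fun ω => ((η ω, κ ω) : AugEnv d)))
    (herg : ErgodicShifts μ (fun ω => ((η ω, κ ω) : AugEnv d)))
    (hwalks : IndepWalksGiven μ η κ S)
    (Pbar : Measure (AugEnv d)) [IsProbabilityMeasure Pbar]
    (hinv : (augKernel d).Invariant Pbar)
    (hac : Pbar ≪ (ProbabilityTheory.cond μ {ω | (cluster (κ ω).1 0).Infinite}).map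
      (fun ω => ((η ω, κ ω) : AugEnv d)))
    (hca : (ProbabilityTheory.cond μ {ω | (cluster (κ ω).1 0).Infinite}).map
      (fun ω => ((η ω, κ ω) : AugEnv d)) ≪ Pbar) :
    ZeroOneLaw μ η κ S := by
  obtain ⟨G⟩ : Nonempty (StepRule d) := inferInstance
  have hκη : Measurable fun ω => ((η ω, κ ω) : AugEnv d) := hη.prodMk hκ
  set L := μ.map fun ω => ((η ω, κ ω) : AugEnv d) with hLdef
  have : IsProbabilityMeasure L := Measure.isProbabilityMeasure_map hκη.aemeasurable
  have hL : ∀ z, L.map (shiftAug z) = L := by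
    intro z
    rw [hLdef, Measure.map_map (measurable_shiftAug z) hκη]
    exact hstat z
  have hcl : ∀ v : Zd d, MeasurableSet {p : AugEnv d | (cluster p.2.1 v).Infinite} := fun v =>
    measurableSet_cluster_infinite (p := fun p : AugEnv d => p.2.1)
      (fun x z => (measurable_entry x z).comp measurable_snd) v
  have hrestrict : L.restrict {p | (cluster p.2.1 0).Infinite} ≪ Pbar := by
    rw [hLdef, Measure.restrict_map hκη (hcl 0)]
    refine Measure.AbsolutelyContinuous.trans (Measure.AbsolutelyContinuous.map ?_ hκη) hca
    -- The conditioned measure is the restriction of `μ` times an inverse probability, which is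
    -- nonzero because the probability is finite.
    exact Measure.absolutelyContinuous_smul (ENNReal.inv_ne_zero.2 (measure_ne_top _ _))
  have hharm := ae_hitRec_harmonic_of_cluster G L Pbar hinv hL hrestrict
  have hL_erg : ∀ B, MeasurableSet B → (∀ z, shiftAug z ⁻¹' B = B) → L B = 0 ∨ L B = 1 := by
    intro B hB hBinv
    rw [hLdef, Measure.map_apply hκη hB]
    refine herg _ (hκη hB) ⟨B, hB, fun z => Filter.EventuallyEq.of_eq ?_⟩
    ext ω
    exact (Set.ext_iff.1 (hBinv z) (η ω, κ ω)).symm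
  have huniq : ∀ᵐ p ∂L, ∀ x y, (cluster p.2.1 x).Infinite → (cluster p.2.1 y).Infinite →
      cluster p.2.1 x = cluster p.2.1 y := by
    refine ae_all_iff.2 fun x => ae_all_iff.2 fun y => ?_
    have hreach : ∀ a b : Zd d, MeasurableSet {p : AugEnv d | CanReach p.2.1 a b} :=
      measurableSet_reflTransGen fun a b => measurableSet_lt measurable_const
        ((measurable_entry a b).comp measurable_snd)
    have hset : MeasurableSet {p : AugEnv d | (cluster p.2.1 x).Infinite →
        (cluster p.2.1 y).Infinite → cluster p.2.1 x = cluster p.2.1 y} := by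
      refine ((hcl x).compl.union ((hcl y).compl.union
        ((hreach x y).inter (hreach y x)))).congr ?_
      ext p
      have : (cluster p.2.1 x = cluster p.2.1 y) ↔ CanReach p.2.1 x y ∧ CanReach p.2.1 y x :=
        ⟨fun h => (Set.ext_iff.1 h y).2 ⟨.refl, .refl⟩, fun h => (cluster_eq_of_mem h).symm⟩
      simp only [Set.mem_union, Set.mem_compl_iff, Set.mem_inter_iff, Set.mem_ofPred_eq, this]
      tauto
    refine (ae_map_iff hκη.aemeasurable hset).2 ?_
    filter_upwards [hUC] with ω hω
    exact hω x y
  have hrec := measure_recurrent_eq G μ hη hκ hS hS0 hwalks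
  rcases recSet_zero_one hd G L hL hL_erg with h0 | h1
  · left
    intro v
    rw [hrec v]
    refine (lintegral_congr_ae ?_).trans lintegral_zero
    filter_upwards [h0] with p hp
    refine measure_eq_zero_iff_ae_notMem.2 ?_
    filter_upwards [hp] with U hU hv
    exact hU ⟨v, hv⟩
  · right
    intro v
    have hm : MeasurableSet {p : AugEnv d | 1 ≤ p.1 v ∧ (cluster p.2.1 v).Infinite} :=
      (measurableSet_le measurable_const ((measurable_pi_apply v).comp measurable_fst)).inter (hcl v)
    have hset : {ω | 1 ≤ η ω v ∧ (cluster (κ ω).1 v).Infinite} =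
        (fun ω => ((η ω, κ ω) : AugEnv d)) ⁻¹'
          {p : AugEnv d | 1 ≤ p.1 v ∧ (cluster p.2.1 v).Infinite} := rfl
    -- It remains to show that the quenched probability of recurrence equals the indicator of an
    -- occupied site with infinite cluster, for almost every environment.
    rw [hrec v, hset, ← Measure.map_apply hκη hm, ← hLdef, ← lintegral_indicator_one hm]
    refine lintegral_congr_ae ?_
    filter_upwards [h1, hharm, huniq] with p hD hH hU
    by_cases hp : 1 ≤ p.1 v ∧ (cluster p.2.1 v).Infinite
    · rw [Set.indicator_of_mem (s := {p : AugEnv d | 1 ≤ p.1 v ∧ (cluster p.2.1 v).Infinite}) hp,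
        Pi.one_apply]
      refine le_antisymm prob_le_one ?_
      rw [← measure_univ (μ := frogLaw (Zd d) (volume : Measure unitInterval))]
      exact measure_mono_ae (by
        filter_upwards [ae_mem_recSet G p hD hH hU hp.1 hp.2] with U hU _
        exact hU)
    · rw [Set.indicator_of_notMem (s := {p : AugEnv d | 1 ≤ p.1 v ∧ (cluster p.2.1 v).Infinite}) hp]
      refine measure_eq_zero_iff_ae_notMem.2 ?_
      filter_upwards [ae_canReach_frogs G p.2] with U hU hv
      exact hp (InfVisits.cluster_infinite hU hv)
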